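/- All drawings are in $\mathbb{R}^2$. A planar drawing of a digraph maps distinct vertices to distinct points and each edge to a Jordan arc joining its end-vertices, so that no edge passes through another vertex and two edges meet only at common end-vertices; it is upward if every edge is strictly increasing in the $y$-direction from its tail to its head, and a digraph is upward planar if it has an upward planar drawing. An $st$-digraph is a directed acyclic graph with a single source and a single sink. A digraph is $2$-outerplanar if it has a planar drawing such that removing all vertices on the boundary of the outer face leaves an outerplanar drawing, i.e. one with all its vertices on the boundary of its outer face. An upward one-sided convex (UOSC) point set is a finite set $S$ of points in convex position with pairwise distinct $y$-coordinates whose lowest and highest points are adjacent in the convex hull of $S$, all the other points lying to the left of the line through these two (directed upwards). A $1$-bend upward point-set embedding (UPSE) of $G=(V,E)$ on a point set $S$ with $|S|=|V|$ is an upward planar drawing of $G$ whose vertices are exactly the points of $S$ and in which every edge is a polyline with at most one bend. **Theorem.** For every $n \ge 18$ there exist an $n$-vertex upward planar $2$-outerplanar $st$-digraph $G$ and a UOSC point set $S$ with $|S| = n$ such that $G$ does not admit a $1$-bend UPSE on $S$. -/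

import Mathlib

namespace UpwardEmbedding

/-- The Euclidean plane, in Cartesian coordinates (its topology and affine structure are used,
no particular norm is). The second coordinate is the vertical one. -/
abbrev Plane : Type := ℝ × ℝ

/-! ### Digraphs and their planar drawings -/

/-- An `st`-digraph: a directed acyclic graph with a single source and a single sink. -/
structure IsStDigraph {V : Type*} (G : Digraph V) : Prop where
  acyclic : ∀ v, ¬ Relation.TransGen G.Adj v v
  single_source : ∃! s, ∀ v, ¬ G.Adj v s
  single_sink : ∃! t, ∀ v, ¬ G.Adj t v

/-- The subdigraph of `G` induced by a set `W` of vertices. -/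
def inducedDigraph {V : Type*} (G : Digraph V) (W : Set V) : Digraph W where
  Adj a b := G.Adj a b

/-- A planar drawing of `G`: distinct vertices are distinct points, each edge is a Jordan arc
joining its end-vertices and passing through no other vertex, and two distinct edges meet only
at vertices (hence only at common end-vertices). -/
structure PlanarDrawing {V : Type*} (G : Digraph V) where
  pos : V → Plane
  arc : ∀ u v : V, G.Adj u v → Path (pos u) (pos v)
  pos_injective : Function.Injective pos
  arc_injective : ∀ (u v : V) (h : G.Adj u v), Function.Injective (arc u v h)
  vertex_on_arc : ∀ (u v : V) (h : G.Adj u v) (w : V),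
    pos w ∈ Set.range (arc u v h) → w = u ∨ w = v
  arc_inter_arc : ∀ (u v : V) (h : G.Adj u v) (u' v' : V) (h' : G.Adj u' v'),
    (u, v) ≠ (u', v') →
      Set.range (arc u v h) ∩ Set.range (arc u' v' h') ⊆ Set.range pos

namespace PlanarDrawing

variable {V : Type*} {G : Digraph V}

/-- The set of all points of the plane that lie on a vertex or an edge of the drawing. -/
def image (Γ : PlanarDrawing G) : Set Plane :=
  Set.range Γ.pos ∪ {p | ∃ (u v : V) (h : G.Adj u v), p ∈ Set.range (Γ.arc u v h)}

/-- The outer face: the points off the drawing whose connected component in the complement of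
the drawing is unbounded. -/
def outerFace (Γ : PlanarDrawing G) : Set Plane :=
  {p | p ∈ Γ.imageᶜ ∧ ¬ Bornology.IsBounded (connectedComponentIn Γ.imageᶜ p)}

/-- The vertex `v` belongs to the boundary of the outer face. -/
def OnOuterFace (Γ : PlanarDrawing G) (v : V) : Prop :=
  Γ.pos v ∈ frontier Γ.outerFace

/-- An outerplanar drawing: all vertices belong to the boundary of the outer face. -/
def IsOuterplanar (Γ : PlanarDrawing G) : Prop :=
  ∀ v, Γ.OnOuterFace v

/-- The drawing of the subdigraph induced by `W` that remains after deleting all the other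
vertices and the edges incident to them. -/
def restrict (Γ : PlanarDrawing G) (W : Set V) : PlanarDrawing (inducedDigraph G W) where
  pos w := Γ.pos w
  arc u v h := Γ.arc u v h
  pos_injective := fun _ _ h => Subtype.ext (Γ.pos_injective h)
  arc_injective u v h := Γ.arc_injective u v h
  vertex_on_arc u v h w hw := by
    rcases Γ.vertex_on_arc u v h w hw with h' | h'
    · exact Or.inl (Subtype.ext h')
    · exact Or.inr (Subtype.ext h')
  arc_inter_arc u v h u' v' h' hne p hp := by
    have hne' : ((u : V), (v : V)) ≠ ((u' : V), (v' : V)) := by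
      intro he
      rw [Prod.mk.injEq] at he
      exact hne (Prod.ext (Subtype.ext he.1) (Subtype.ext he.2))
    obtain ⟨w, rfl⟩ := Γ.arc_inter_arc u v h u' v' h' hne' hp
    rcases Γ.vertex_on_arc u v h w hp.1 with h1 | h1
    · exact ⟨u, by rw [h1]⟩
    · exact ⟨v, by rw [h1]⟩

/-- A drawing is upward if every edge, traversed from its tail to its head, is strictly
increasing in the `y`-direction. -/
def IsUpward (Γ : PlanarDrawing G) : Prop :=
  ∀ (u v : V) (h : G.Adj u v), StrictMono fun τ : unitInterval => (Γ.arc u v h τ).2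

end PlanarDrawing

/-- `G` is upward planar if it has an upward planar drawing. -/
def IsUpwardPlanar {V : Type*} (G : Digraph V) : Prop :=
  ∃ Γ : PlanarDrawing G, Γ.IsUpward

/-- `G` is `2`-outerplanar if it has a planar drawing such that deleting all vertices of the
outer face leaves an outerplanar drawing. -/
def IsTwoOuterplanar {V : Type*} (G : Digraph V) : Prop :=
  ∃ Γ : PlanarDrawing G, (Γ.restrict {v | ¬ Γ.OnOuterFace v}).IsOuterplanar

/-! ### Point-set embeddings -/

/-- The polygonal line through the points of a list, in this order. -/
def polyline : List Plane → Set Plane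
  | [] => ∅
  | [p] => {p}
  | p :: q :: l => segment ℝ p q ∪ polyline (q :: l)

/-- `Γ` is a `b`-bend upward point-set embedding on `S`: an upward planar drawing whose vertices
are exactly the points of `S` and in which each edge is a polyline with at most `b` bends. -/
structure IsUPSE {V : Type*} {G : Digraph V} (Γ : PlanarDrawing G) (S : Finset Plane) (b : ℕ) :
    Prop where
  range_pos : Set.range Γ.pos = (S : Set Plane)
  upward : Γ.IsUpward
  bends : ∀ (u v : V) (h : G.Adj u v), ∃ l : List Plane,
    l.length ≤ b ∧ Set.range (Γ.arc u v h) = polyline (Γ.pos u :: (l ++ [Γ.pos v]))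

/-- `G` admits a `b`-bend upward point-set embedding on `S`. -/
def AdmitsUPSE {V : Type*} (G : Digraph V) (S : Finset Plane) (b : ℕ) : Prop :=
  ∃ Γ : PlanarDrawing G, IsUPSE Γ S b

/-- The point `r` lies strictly to the left of the line through `p` and `q`, directed from `p`
to `q`. -/
def StrictlyLeftOf (p q r : Plane) : Prop :=
  0 < (q.1 - p.1) * (r.2 - p.2) - (q.2 - p.2) * (r.1 - p.1)

/-- Upward one-sided convex point sets: the points are in convex position, no two have the same
height, and the lowest point and the highest point are adjacent in the convex hull, i.e. the
segment joining them lies on its boundary, all the other points being to the left of it. -/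
structure IsUOSC (S : Finset Plane) : Prop where
  convex_position : ∀ p ∈ S, p ∉ convexHull ℝ ((S : Set Plane) \ {p})
  heights_distinct : ∀ p ∈ S, ∀ q ∈ S, p.2 = q.2 → p = q
  one_sided : ∃ b ∈ S, ∃ t ∈ S, (∀ p ∈ S, b.2 ≤ p.2 ∧ p.2 ≤ t.2) ∧
    segment ℝ b t ⊆ frontier (convexHull ℝ (S : Set Plane)) ∧
    ∀ p ∈ S, p ≠ b → p ≠ t → StrictlyLeftOf b t p

end UpwardEmbedding

/-!
Why some `2`-outerplanar `st`-digraphs have no one-bend upward embedding on some UOSC point set.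

The points lie on the parabola `x = y ^ 2`, at heights chosen so that the two lowest ones and all
from the thirteenth on are remote, while the ten others have the heights `1, …, 10`. A *core*
digraph on `0, …, 12` has source `0`, sink `12`, an edge `0 → 1`, and an edge `1 → 12` on whose two
sides two copies `2, …, 6` and `7, …, 11` of one five-vertex digraph are placed; further vertices
form a path above `12`. In an embedding the heights extend the order of the digraph, so `0`, `1`
and `12` occupy the points of the same ranks, and the two copies occupy the ten middle points
(`rank_eq`).

An edge drawn upward with at most one bend is the graph of a function of the height with at most
two affine pieces (`OneBend`, `exists_oneBend`). By the intermediate value theorem, two curves made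
of edges keep their left-to-right order as long as they pass no common vertex
(`CoreDrawing.IsCurve.lt_of_lt`), which is all the planarity that is needed. It gives that the edge
`1 → 12` separates the two copies (`CoreDrawing.separated`); let `2, …, 6` be on its left, the other
case being symmetric.

The heights at which a one-bend edge is to the left of the parabola form an interval, so that no
vertex of the left copy has a height between those of `7` and `8`
(`OneBend.not_left_right_left`). Both ends of `1 → 12` are remote, so both of its segments are
almost horizontal, and since it passes to the left of `7` and `8` it goes far to the left between
their heights (`OneBend.far_left`). However, whatever gap of the increasing sequence `2, …, 6`
contains `7` and `8`, an edge of the left copy spans that gap: one of `1 → 4`, `2 → 4`, `4 → 6` and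
`4 → 12`. It passes to the right of `3` or `5`, next to an end-vertex of its own that is not remote,
so one of its segments has a bounded slope, and it cannot go far to the left
(`OneBend.bounded_above`, `OneBend.bounded_below`). As it is to the left of `1 → 12`, this is a
contradiction (`CoreDrawing.false_of_left`).

Upward planarity and `2`-outerplanarity are both shown by one straight-line drawing with integer
coordinates (`drawing`), in which every vertex has an unobstructed horizontal ray to infinity, at the
latest after deletion of the vertices of the outer face.
-/

namespace UpwardEmbedding

open Set

/-! ### Edges with at most one bend -/

/-- `φ` is the abscissa, as a function of the height, of an upward polygonal line with at most one
bend from `(xa, a)` to `(xb, b)`; the bend is at the height `h`, and `h = a` or `h = b` stands for a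
straight segment. -/
def OneBend (φ : ℝ → ℝ) (a xa b xb : ℝ) : Prop :=
  ∃ h ∈ Icc a b, ∃ k l : ℝ, (∀ y ∈ Icc a h, φ y = xa + k * (y - a)) ∧
    ∀ y ∈ Icc h b, φ y = xb + l * (y - b)

namespace OneBend

variable {φ : ℝ → ℝ} {a xa b xb : ℝ}

theorem apply_left (H : OneBend φ a xa b xb) : φ a = xa := by
  obtain ⟨h, hh, k, l, h1, -⟩ := H
  simp [h1 a ⟨le_rfl, hh.1⟩]

theorem apply_right (H : OneBend φ a xa b xb) : φ b = xb := by
  obtain ⟨h, hh, k, l, -, h2⟩ := H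
  simp [h2 b ⟨hh.2, le_rfl⟩]

theorem continuousOn (H : OneBend φ a xa b xb) : ContinuousOn φ (Icc a b) := by
  obtain ⟨h, hh, k, l, h1, h2⟩ := H
  rw [← Icc_union_Icc_eq_Icc hh.1 hh.2]
  refine ContinuousOn.union_of_isClosed ?_ ?_ isClosed_Icc isClosed_Icc
  · exact ContinuousOn.congr (by fun_prop) h1
  · exact ContinuousOn.congr (by fun_prop) h2

/-- The heights at which a one-bend edge with both ends on the parabola `x = y ^ 2` is to the left
of the parabola form an interval. -/
theorem not_left_right_left (H : OneBend φ a (a ^ 2) b (b ^ 2)) {α γ δ : ℝ} (h1 : a < α)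
    (h2 : α < γ) (h3 : γ < δ) (h4 : δ < b) (hα : φ α < α ^ 2) (hγ : γ ^ 2 < φ γ)
    (hδ : φ δ < δ ^ 2) : False := by
  obtain ⟨h, hh, k, l, e1, e2⟩ := H
  rcases le_total γ h with hγh | hγh
  · rw [e1 α ⟨h1.le, by linarith⟩] at hα
    rw [e1 γ ⟨by linarith, hγh⟩] at hγ
    have u1 : k < α + a := by
      by_contra! hk
      nlinarith
    have u2 : γ + a < k := by
      by_contra! hk
      nlinarith
    linarith
  · rw [e2 δ ⟨by linarith, h4.le⟩] at hδ
    rw [e2 γ ⟨hγh, by linarith⟩] at hγ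
    have u1 : δ + b < l := by
      by_contra! hk
      nlinarith
    have u2 : l < γ + b := by
      by_contra! hk
      nlinarith
    linarith

/-- A one-bend edge between two remote points of the parabola that passes to the left of two
points of the parabola close to the vertex goes far to the left between them, since both of its
segments are almost horizontal. -/
theorem far_left (H : OneBend φ a (a ^ 2) b (b ^ 2)) (ha : a ≤ -10000) (hb : 10000 ≤ b)
    {α δ : ℝ} (hα1 : 1 ≤ α) (hαδ : α + 1 ≤ δ) (hδ1 : δ ≤ 10) (hα : φ α < α ^ 2)
    (hδ : φ δ < δ ^ 2) : φ ((α + δ) / 2) < -1000 := by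
  obtain ⟨h, hh, k, l, e1, e2⟩ := H
  rcases le_total ((α + δ) / 2) h with hm | hm
  · rw [e1 α ⟨by linarith, by linarith⟩] at hα
    rw [e1 _ ⟨by linarith, hm⟩]
    have u1 : k < α + a := by
      by_contra! hk
      nlinarith
    nlinarith
  · rw [e2 δ ⟨by linarith, by linarith⟩] at hδ
    rw [e2 _ ⟨hm, by linarith⟩]
    have u1 : δ + b < l := by
      by_contra! hk
      nlinarith
    nlinarith

/-- A one-bend edge between points of nonnegative abscissa cannot be far to the left after having
passed a point of nonnegative abscissa at a bounded slope. -/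
theorem bounded_above (H : OneBend φ a xa b xb) (ha1 : 1 ≤ a) (hxa : xa ≤ 100) (hxa0 : 0 ≤ xa)
    (hxb : 0 ≤ xb) {γ m : ℝ} (hγ : a + 1 ≤ γ) (hγm : γ ≤ m) (hm : m ≤ 10) (hmb : m ≤ b)
    (hφ : 0 ≤ φ γ) : -1000 ≤ φ m := by
  obtain ⟨h, hh, k, l, e1, e2⟩ := H
  rcases le_total γ h with hγh | hγh
  · rw [e1 γ ⟨by linarith, hγh⟩] at hφ
    have hk : -100 ≤ k := by
      by_contra! hk
      nlinarith
    have key : ∀ y ∈ Icc a h, y ≤ 10 → -1000 ≤ φ y := by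
      intro y hy hy1
      rw [e1 y hy]
      nlinarith [hy.1]
    rcases le_total m h with hmh | hmh
    · exact key m ⟨by linarith, hmh⟩ hm
    · have h0 := key h ⟨hh.1, le_rfl⟩ (by linarith)
      rw [e2 h ⟨le_rfl, hh.2⟩] at h0
      rw [e2 m ⟨hmh, hmb⟩]
      rcases le_total 0 l with hl | hl <;> nlinarith
  · rw [e2 γ ⟨hγh, by linarith⟩] at hφ
    rw [e2 m ⟨by linarith, hmb⟩]
    rcases le_total 0 l with hl | hl <;> nlinarith

/-- The mirror image of `OneBend.bounded_above`, for heights below that of the point passed. -/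
theorem bounded_below (H : OneBend φ a xa b xb) (hb1 : b ≤ 10) (hxb : xb ≤ 100) (hxb0 : 0 ≤ xb)
    (hxa : 0 ≤ xa) {γ m : ℝ} (hγ : γ + 1 ≤ b) (hγm : m ≤ γ) (hm : 1 ≤ m) (hma : a ≤ m)
    (hφ : 0 ≤ φ γ) : -1000 ≤ φ m := by
  obtain ⟨h, hh, k, l, e1, e2⟩ := H
  rcases le_total h γ with hγh | hγh
  · rw [e2 γ ⟨hγh, by linarith⟩] at hφ
    have hl : l ≤ 100 := by
      by_contra! hl
      nlinarith
    have key : ∀ y ∈ Icc h b, 1 ≤ y → -1000 ≤ φ y := by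
      intro y hy hy1
      rw [e2 y hy]
      nlinarith [hy.2]
    rcases le_total h m with hmh | hmh
    · exact key m ⟨hmh, by linarith⟩ hm
    · have h0 := key h ⟨le_rfl, hh.2⟩ (by linarith)
      rw [e1 h ⟨hh.1, le_rfl⟩] at h0
      rw [e1 m ⟨hma, hmh⟩]
      rcases le_total 0 k with hl | hl <;> nlinarith
  · rw [e1 γ ⟨by linarith, hγh⟩] at hφ
    rw [e1 m ⟨hma, by linarith⟩]
    rcases le_total 0 k with hl | hl <;> nlinarith

end OneBend

/-! ### Drawings of the core digraph -/

/-- The edges of the core digraph on `{0, …, 12}`: the source `0`, its successor `1`, the sink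
`12`, and two copies `2, …, 6` and `7, …, 11` of the same five-vertex digraph, which the edge
`1 → 12` separates in every upward drawing. -/
def coreEdges : List (ℕ × ℕ) :=
  [(0, 1), (1, 12),
   (0, 3), (0, 5), (1, 2), (1, 4), (2, 3), (3, 4), (2, 4), (4, 5), (5, 6), (4, 6), (4, 12), (6, 12),
   (0, 8), (0, 10), (1, 7), (1, 9), (7, 8), (8, 9), (7, 9), (9, 10), (10, 11), (9, 11), (9, 12),
   (11, 12)]

/-- Adjacency in the core digraph. -/
abbrev CoreAdj (u v : Fin 13) : Prop := (u.val, v.val) ∈ coreEdges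

/-- What a one-bend upward drawing of the core digraph on points of the parabola `x = y ^ 2`
provides: the height `Y v` of each vertex, and the abscissa `g u v` of each edge as a function of
the height. The end-vertices `1` and `12` of the separating edge are remote, and the vertices of
the two copies are close to the vertex of the parabola. -/
structure CoreDrawing where
  Y : Fin 13 → ℝ
  g : Fin 13 → Fin 13 → ℝ → ℝ
  lt_of_adj : ∀ u v, CoreAdj u v → Y u < Y v
  low : Y 1 ≤ -10000
  high : 10000 ≤ Y 12
  mid : ∀ v, v ≠ 0 → v ≠ 1 → v ≠ 12 → 1 ≤ Y v ∧ Y v ≤ 10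
  gap : ∀ u v, u ≠ 0 → u ≠ 1 → v ≠ 12 → Y u < Y v → Y u + 1 ≤ Y v
  oneBend : ∀ u v, CoreAdj u v → OneBend (g u v) (Y u) (Y u ^ 2) (Y v) (Y v ^ 2)
  meet : ∀ u v u' v', CoreAdj u v → CoreAdj u' v' → (u, v) ≠ (u', v') →
    ∀ y ∈ Icc (Y u) (Y v), y ∈ Icc (Y u') (Y v') → g u v y = g u' v' y →
      ∃ w, (w = u ∨ w = v) ∧ (w = u' ∨ w = v') ∧ Y w = y

namespace CoreDrawing

variable (D : CoreDrawing)

/-- `φ` describes, on the heights from `a` to `b`, an upward curve made of edges that join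
vertices of `vs`. -/
structure IsCurve (vs : Finset (Fin 13)) (a b : Fin 13) (φ : ℝ → ℝ) : Prop where
  le : D.Y a ≤ D.Y b
  cont : ContinuousOn φ (Icc (D.Y a) (D.Y b))
  left : φ (D.Y a) = D.Y a ^ 2
  right : φ (D.Y b) = D.Y b ^ 2
  mem : ∀ y ∈ Icc (D.Y a) (D.Y b), ∃ u ∈ vs, ∃ v ∈ vs, CoreAdj u v ∧
    y ∈ Icc (D.Y u) (D.Y v) ∧ φ y = D.g u v y

variable {D}

theorem IsCurve.edge {u v : Fin 13} (h : CoreAdj u v) : D.IsCurve {u, v} u v (D.g u v) where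
  le := (D.lt_of_adj u v h).le
  cont := (D.oneBend u v h).continuousOn
  left := (D.oneBend u v h).apply_left
  right := (D.oneBend u v h).apply_right
  mem := fun y hy => ⟨u, by simp, v, by simp, h, hy, rfl⟩

theorem IsCurve.concat {vs vs' : Finset (Fin 13)} {a b c : Fin 13} {φ ψ : ℝ → ℝ}
    (h : D.IsCurve vs a b φ) (h' : D.IsCurve vs' b c ψ) :
    ∃ χ, D.IsCurve (vs ∪ vs') a c χ ∧ χ (D.Y b) = D.Y b ^ 2 := by
  have e1 : EqOn (fun y => if y ≤ D.Y b then φ y else ψ y) φ (Icc (D.Y a) (D.Y b)) :=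
    fun y hy => if_pos hy.2
  have e2 : EqOn (fun y => if y ≤ D.Y b then φ y else ψ y) ψ (Icc (D.Y b) (D.Y c)) := by
    intro y hy
    by_cases hb : y ≤ D.Y b
    · have : y = D.Y b := le_antisymm hb hy.1
      subst this
      simp [h.right, h'.left]
    · exact if_neg hb
  refine ⟨fun y => if y ≤ D.Y b then φ y else ψ y, ⟨h.le.trans h'.le, ?_, ?_, ?_, ?_⟩, ?_⟩
  · rw [← Icc_union_Icc_eq_Icc h.le h'.le]
    exact ContinuousOn.union_of_isClosed (h.cont.congr e1) (h'.cont.congr e2) isClosed_Icc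
      isClosed_Icc
  · exact (e1 ⟨le_rfl, h.le⟩).trans h.left
  · exact (e2 ⟨h'.le, le_rfl⟩).trans h'.right
  · intro y hy
    rcases le_total y (D.Y b) with hb | hb
    · obtain ⟨u, hu, v, hv, ha, hi, e⟩ := h.mem y ⟨hy.1, hb⟩
      exact ⟨u, Finset.mem_union_left _ hu, v, Finset.mem_union_left _ hv, ha, hi,
        (e1 ⟨hy.1, hb⟩).trans e⟩
    · obtain ⟨u, hu, v, hv, ha, hi, e⟩ := h'.mem y ⟨hb, hy.2⟩
      exact ⟨u, Finset.mem_union_right _ hu, v, Finset.mem_union_right _ hv, ha, hi,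
        (e2 ⟨hb, hy.2⟩).trans e⟩
  · exact (e1 ⟨h.le, le_rfl⟩).trans h.right

/-- Two curves without a common edge meet only at common vertices. -/
theorem IsCurve.ne {vs vs' : Finset (Fin 13)} {a b a' b' : Fin 13} {φ ψ : ℝ → ℝ}
    (h : D.IsCurve vs a b φ) (h' : D.IsCurve vs' a' b' ψ)
    (hE : ∀ u v, CoreAdj u v → u ∈ vs ∩ vs' → v ∉ vs ∩ vs') {y : ℝ}
    (hy : y ∈ Icc (D.Y a) (D.Y b)) (hy' : y ∈ Icc (D.Y a') (D.Y b'))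
    (hv : ∀ w ∈ vs ∩ vs', D.Y w ≠ y) : φ y ≠ ψ y := by
  intro he
  obtain ⟨u, hu, v, hv1, ha, hi, e⟩ := h.mem y hy
  obtain ⟨u', hu', v', hv', ha', hi', e'⟩ := h'.mem y hy'
  by_cases hne : (u, v) = (u', v')
  · rw [Prod.mk.injEq] at hne
    obtain ⟨rfl, rfl⟩ := hne
    exact hE u v ha (Finset.mem_inter.2 ⟨hu, hu'⟩) (Finset.mem_inter.2 ⟨hv1, hv'⟩)
  · obtain ⟨w, hw, hw', hwy⟩ := D.meet u v u' v' ha ha' hne y hi hi' (by rw [← e, ← e', he])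
    refine hv w (Finset.mem_inter.2 ⟨?_, ?_⟩) hwy
    · rcases hw with rfl | rfl <;> assumption
    · rcases hw' with rfl | rfl <;> assumption

/-- Of two curves that share no edge, the same one is the left one over any interval of heights
that contains no common vertex. -/
theorem IsCurve.lt_of_lt {vs vs' : Finset (Fin 13)} {a b a' b' : Fin 13} {φ ψ : ℝ → ℝ}
    (h : D.IsCurve vs a b φ) (h' : D.IsCurve vs' a' b' ψ)
    (hE : ∀ u v, CoreAdj u v → u ∈ vs ∩ vs' → v ∉ vs ∩ vs') {α β : ℝ}
    (h1 : D.Y a ≤ α) (h2 : D.Y a' ≤ α) (h3 : β ≤ D.Y b) (h4 : β ≤ D.Y b')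
    (hv : ∀ w ∈ vs ∩ vs', D.Y w < α ∨ β < D.Y w) {x y : ℝ} (hx : x ∈ Icc α β) (hy : y ∈ Icc α β)
    (hlt : φ x < ψ x) : φ y < ψ y := by
  by_contra! hle
  obtain ⟨z, hz, e⟩ := isPreconnected_Icc.intermediate_value₂ hx hy
    (h.cont.mono (Icc_subset_Icc h1 h3)) (h'.cont.mono (Icc_subset_Icc h2 h4)) hlt.le hle
  refine h.ne h' hE ⟨h1.trans hz.1, hz.2.trans h3⟩ ⟨h2.trans hz.1, hz.2.trans h4⟩ ?_ e
  rintro w hw rfl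
  rcases hv w hw with hw | hw
  · exact absurd hz.1 (not_le.2 hw)
  · exact absurd hz.2 (not_le.2 hw)

variable (D)

/-! ### Nonexistence of one-bend drawings of the core digraph -/

/-- The exchange of the two copies in the core digraph. -/
def mirror : Fin 13 → Fin 13 :=
  ![0, 1, 7, 8, 9, 10, 11, 2, 3, 4, 5, 6, 12]

theorem mirror_mirror : ∀ v, mirror (mirror v) = v := by decide

theorem coreAdj_mirror : ∀ u v, CoreAdj u v → CoreAdj (mirror u) (mirror v) := by decide

theorem mirror_eq_iff (u v : Fin 13) : mirror u = v ↔ u = mirror v := by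
  revert u v
  decide

/-- The same drawing, with the names of the two copies exchanged. -/
def swap : CoreDrawing where
  Y v := D.Y (mirror v)
  g u v := D.g (mirror u) (mirror v)
  lt_of_adj u v h := D.lt_of_adj _ _ (coreAdj_mirror u v h)
  low := D.low
  high := D.high
  mid v h0 h1 h2 := D.mid _ (fun h => h0 ((mirror_eq_iff _ _).1 h))
    (fun h => h1 ((mirror_eq_iff _ _).1 h)) (fun h => h2 ((mirror_eq_iff _ _).1 h))
  gap u v h0 h1 h2 := D.gap _ _ (fun h => h0 ((mirror_eq_iff _ _).1 h))
    (fun h => h1 ((mirror_eq_iff _ _).1 h)) (fun h => h2 ((mirror_eq_iff _ _).1 h))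
  oneBend u v h := D.oneBend _ _ (coreAdj_mirror u v h)
  meet u v u' v' h h' hne y hy hy' he := by
    obtain ⟨w, h1, h2, h3⟩ := D.meet _ _ _ _ (coreAdj_mirror u v h) (coreAdj_mirror u' v' h')
      (fun e => hne (by
        rw [Prod.mk.injEq] at e ⊢
        rw [← mirror_mirror u, ← mirror_mirror v, e.1, e.2, mirror_mirror, mirror_mirror]
        exact ⟨rfl, rfl⟩)) y hy hy' he
    refine ⟨mirror w, ?_, ?_, by rw [mirror_mirror]; exact h3⟩
    · simpa only [mirror_eq_iff] using h1
    · simpa only [mirror_eq_iff] using h2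

/-- The curve from source to sink through `3` and `4`. -/
theorem exists_curve₁ : ∃ φ, D.IsCurve {0, 3, 4, 12} 0 12 φ ∧ φ (D.Y 4) = D.Y 4 ^ 2 := by
  obtain ⟨χ, h, -⟩ := (IsCurve.edge (D := D) (u := 0) (v := 3) (by decide)).concat
    (IsCurve.edge (u := 3) (v := 4) (by decide))
  exact h.concat (IsCurve.edge (u := 4) (v := 12) (by decide))

/-- The curve from source to sink through `8` and `9`. -/
theorem exists_curve₂ : ∃ φ, D.IsCurve {0, 8, 9, 12} 0 12 φ ∧ φ (D.Y 9) = D.Y 9 ^ 2 := by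
  obtain ⟨χ, h, -⟩ := (IsCurve.edge (D := D) (u := 0) (v := 8) (by decide)).concat
    (IsCurve.edge (u := 8) (v := 9) (by decide))
  exact h.concat (IsCurve.edge (u := 9) (v := 12) (by decide))

/-- The edge `1 → 12` separates the two copies. At the height of the vertex `1`, this vertex and
the curve through one copy are on the same side of the curve through the other copy, because an
edge joins `1` to the former curve without crossing the latter. Hence `1` is between the two
curves. -/
theorem separated : (D.Y 4 ^ 2 < D.g 1 12 (D.Y 4) ∧ D.g 1 12 (D.Y 9) < D.Y 9 ^ 2) ∨
    (D.Y 9 ^ 2 < D.g 1 12 (D.Y 9) ∧ D.g 1 12 (D.Y 4) < D.Y 4 ^ 2) := by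
  obtain ⟨φ, hφ, hφ4⟩ := D.exists_curve₁
  obtain ⟨ψ, hψ, hψ9⟩ := D.exists_curve₂
  have hB := IsCurve.edge (D := D) (u := 1) (v := 12) (by decide)
  have h14 := IsCurve.edge (D := D) (u := 1) (v := 4) (by decide)
  have h19 := IsCurve.edge (D := D) (u := 1) (v := 9) (by decide)
  have y01 := D.lt_of_adj 0 1 (by decide)
  have y14 := D.lt_of_adj 1 4 (by decide)
  have y19 := D.lt_of_adj 1 9 (by decide)
  have y412 := D.lt_of_adj 4 12 (by decide)
  have y912 := D.lt_of_adj 9 12 (by decide)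
  -- the two curves have only their ends in common
  have hφψ : ∀ {x y : ℝ}, x ∈ Ioo (D.Y 0) (D.Y 12) → y ∈ Ioo (D.Y 0) (D.Y 12) →
      (φ x < ψ x → φ y < ψ y) ∧ (ψ x < φ x → ψ y < φ y) := by
    intro x y hx hy
    have key : ∀ w ∈ ({0, 12} : Finset (Fin 13)), D.Y w < min x y ∨ max x y < D.Y w := by
      intro w hw
      rw [Finset.mem_insert, Finset.mem_singleton] at hw
      rcases hw with rfl | rfl
      · exact Or.inl (lt_min hx.1 hy.1)
      · exact Or.inr (max_lt hx.2 hy.2)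
    have hmin : D.Y 0 ≤ min x y := (lt_min hx.1 hy.1).le
    have hmax : max x y ≤ D.Y 12 := (max_lt hx.2 hy.2).le
    exact ⟨hφ.lt_of_lt hψ (by decide) hmin hmin hmax hmax
        (fun w hw => key w ((by decide : _ ⊆ ({0, 12} : Finset (Fin 13))) hw))
        ⟨min_le_left _ _, le_max_left _ _⟩ ⟨min_le_right _ _, le_max_right _ _⟩,
      hψ.lt_of_lt hφ (by decide) hmin hmin hmax hmax
        (fun w hw => key w ((by decide : _ ⊆ ({0, 12} : Finset (Fin 13))) hw))
        ⟨min_le_left _ _, le_max_left _ _⟩ ⟨min_le_right _ _, le_max_right _ _⟩⟩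
  have y1I : D.Y 1 ∈ Ioo (D.Y 0) (D.Y 12) := ⟨y01, by linarith⟩
  have y4I : D.Y 4 ∈ Ioo (D.Y 0) (D.Y 12) := ⟨by linarith, by linarith⟩
  have y9I : D.Y 9 ∈ Ioo (D.Y 0) (D.Y 12) := ⟨by linarith, by linarith⟩
  have none4 : ∀ w ∈ ({1, 4} : Finset (Fin 13)) ∩ {0, 8, 9, 12}, D.Y w < D.Y 1 ∨ D.Y 4 < D.Y w :=
    fun w hw => absurd hw ((by decide : ∀ w, w ∉ ({1, 4} : Finset (Fin 13)) ∩ {0, 8, 9, 12}) w)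
  have none9 : ∀ w ∈ ({1, 9} : Finset (Fin 13)) ∩ {0, 3, 4, 12}, D.Y w < D.Y 1 ∨ D.Y 9 < D.Y w :=
    fun w hw => absurd hw ((by decide : ∀ w, w ∉ ({1, 9} : Finset (Fin 13)) ∩ {0, 3, 4, 12}) w)
  have l1 : D.Y 1 ∈ Icc (D.Y 1) (D.Y 4) := ⟨le_rfl, y14.le⟩
  have r1 : D.Y 4 ∈ Icc (D.Y 1) (D.Y 4) := ⟨y14.le, le_rfl⟩
  have l2 : D.Y 1 ∈ Icc (D.Y 1) (D.Y 9) := ⟨le_rfl, y19.le⟩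
  have r2 : D.Y 9 ∈ Icc (D.Y 1) (D.Y 9) := ⟨y19.le, le_rfl⟩
  have a1 : D.Y 1 ^ 2 < ψ (D.Y 1) → φ (D.Y 1) < ψ (D.Y 1) := fun h => by
    have h' := h14.lt_of_lt hψ (by decide) le_rfl y01.le le_rfl y412.le none4 l1 r1
      (by rwa [h14.left])
    rw [h14.right, ← hφ4] at h'
    exact (hφψ y4I y1I).1 h'
  have a2 : ψ (D.Y 1) < D.Y 1 ^ 2 → ψ (D.Y 1) < φ (D.Y 1) := fun h => by
    have h' := hψ.lt_of_lt h14 (by decide) y01.le le_rfl y412.le le_rfl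
      (by rw [Finset.inter_comm]; exact none4) l1 r1 (by rwa [h14.left])
    rw [h14.right, ← hφ4] at h'
    exact (hφψ y4I y1I).2 h'
  have a3 : D.Y 1 ^ 2 < φ (D.Y 1) → ψ (D.Y 1) < φ (D.Y 1) := fun h => by
    have h' := h19.lt_of_lt hφ (by decide) le_rfl y01.le le_rfl y912.le none9 l2 r2
      (by rwa [h19.left])
    rw [h19.right, ← hψ9] at h'
    exact (hφψ y9I y1I).2 h'
  have a4 : φ (D.Y 1) < D.Y 1 ^ 2 → φ (D.Y 1) < ψ (D.Y 1) := fun h => by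
    have h' := hφ.lt_of_lt h19 (by decide) y01.le le_rfl y912.le le_rfl
      (by rw [Finset.inter_comm]; exact none9) l2 r2 (by rwa [h19.left])
    rw [h19.right, ← hψ9] at h'
    exact (hφψ y9I y1I).1 h'
  have c4 : ∀ w ∈ ({1, 12} : Finset (Fin 13)) ∩ {0, 3, 4, 12},
      D.Y w < D.Y 1 ∨ D.Y 4 < D.Y w := fun w hw => by
    obtain rfl : w = 12 :=
      (by decide : ∀ w, w ∈ ({1, 12} : Finset (Fin 13)) ∩ {0, 3, 4, 12} → w = 12) w hw
    exact Or.inr y412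
  have c9 : ∀ w ∈ ({1, 12} : Finset (Fin 13)) ∩ {0, 8, 9, 12},
      D.Y w < D.Y 1 ∨ D.Y 9 < D.Y w := fun w hw => by
    obtain rfl : w = 12 :=
      (by decide : ∀ w, w ∈ ({1, 12} : Finset (Fin 13)) ∩ {0, 8, 9, 12} → w = 12) w hw
    exact Or.inr y912
  have hne : ∀ {vs : Finset (Fin 13)} {χ : ℝ → ℝ}, D.IsCurve vs 0 12 χ →
      ({0, 1} : Finset (Fin 13)) ∩ vs ⊆ {0} → χ (D.Y 1) ≠ D.Y 1 ^ 2 := by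
    intro vs χ hχ hvs e
    have h01 := IsCurve.edge (D := D) (u := 0) (v := 1) (by decide)
    refine h01.ne hχ ?_ ⟨y01.le, le_rfl⟩ ⟨y01.le, y1I.2.le⟩ ?_ (h01.right.trans e.symm)
    · intro u v ha hu hv
      have hu' := Finset.mem_singleton.1 (hvs hu)
      have hv' := Finset.mem_singleton.1 (hvs hv)
      subst hu' hv'
      exact absurd ha (by decide)
    · intro w hw
      rw [Finset.mem_singleton.1 (hvs hw)]
      exact y01.ne
  rcases lt_or_gt_of_ne (hne hφ (by decide)) with h | h
  · left
    have hb : D.Y 1 ^ 2 < ψ (D.Y 1) := by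
      rcases lt_or_gt_of_ne (hne hψ (by decide)) with h' | h'
      · exact absurd (a2 h') (a4 h).le.not_gt
      · exact h'
    constructor
    · rw [← hφ4]
      exact hφ.lt_of_lt hB (by decide) y01.le le_rfl y412.le y412.le
        (by rw [Finset.inter_comm]; exact c4) l1 r1 (by rwa [hB.left])
    · rw [← hψ9]
      exact hB.lt_of_lt hψ (by decide) le_rfl y01.le y912.le y912.le c9 l2 r2 (by rwa [hB.left])
  · right
    have hb : ψ (D.Y 1) < D.Y 1 ^ 2 := by
      rcases lt_or_gt_of_ne (hne hψ (by decide)) with h' | h'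
      · exact h'
      · exact absurd (a1 h') (a3 h).le.not_gt
    constructor
    · rw [← hψ9]
      exact hψ.lt_of_lt hB (by decide) y01.le le_rfl y912.le y912.le
        (by rw [Finset.inter_comm]; exact c9) l2 r2 (by rwa [hB.left])
    · rw [← hφ4]
      exact hB.lt_of_lt hφ (by decide) le_rfl y01.le y412.le y412.le c4 l1 r1 (by rwa [hB.left])

/-- `IsCurve.lt_of_lt` for two edges without a common end-vertex. -/
theorem edge_lt_of_lt {u v u' v' : Fin 13} (h : CoreAdj u v) (h' : CoreAdj u' v')
    (hd : Disjoint ({u, v} : Finset (Fin 13)) {u', v'}) {x y : ℝ}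
    (hx : x ∈ Icc (D.Y u) (D.Y v)) (hx' : x ∈ Icc (D.Y u') (D.Y v'))
    (hy : y ∈ Icc (D.Y u) (D.Y v)) (hy' : y ∈ Icc (D.Y u') (D.Y v'))
    (hlt : D.g u v x < D.g u' v' x) : D.g u v y < D.g u' v' y := by
  rw [Finset.disjoint_iff_inter_eq_empty] at hd
  refine (IsCurve.edge h).lt_of_lt (IsCurve.edge h') (by simp [hd]) (le_min hx.1 hy.1)
    (le_min hx'.1 hy'.1) (max_le hx.2 hy.2) (max_le hx'.2 hy'.2) (by simp [hd])
    ⟨min_le_left _ _, le_max_left _ _⟩ ⟨min_le_right _ _, le_max_right _ _⟩ hlt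

/-- The sides of some vertices with respect to the edge `1 → 12`. -/
theorem sides (h4 : D.Y 4 ^ 2 < D.g 1 12 (D.Y 4)) (h9 : D.g 1 12 (D.Y 9) < D.Y 9 ^ 2) :
    (D.Y 3 ^ 2 < D.g 1 12 (D.Y 3) ∧ D.Y 5 ^ 2 < D.g 1 12 (D.Y 5)) ∧
      D.g 1 12 (D.Y 7) < D.Y 7 ^ 2 ∧ D.g 1 12 (D.Y 8) < D.Y 8 ^ 2 := by
  have low := D.low
  have high := D.high
  have m3 := D.mid 3 (by decide) (by decide) (by decide)
  have m4 := D.mid 4 (by decide) (by decide) (by decide)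
  have m5 := D.mid 5 (by decide) (by decide) (by decide)
  have m7 := D.mid 7 (by decide) (by decide) (by decide)
  have m8 := D.mid 8 (by decide) (by decide) (by decide)
  have m9 := D.mid 9 (by decide) (by decide) (by decide)
  have y34 := D.lt_of_adj 3 4 (by decide)
  have y45 := D.lt_of_adj 4 5 (by decide)
  have y78 := D.lt_of_adj 7 8 (by decide)
  have y89 := D.lt_of_adj 8 9 (by decide)
  have L : ∀ {u v}, CoreAdj u v → D.g u v (D.Y u) = D.Y u ^ 2 := fun h => (IsCurve.edge h).left
  have R : ∀ {u v}, CoreAdj u v → D.g u v (D.Y v) = D.Y v ^ 2 := fun h => (IsCurve.edge h).right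
  have s3 : D.Y 3 ^ 2 < D.g 1 12 (D.Y 3) := by
    rw [← L (u := 3) (v := 4) (by decide)]
    refine D.edge_lt_of_lt (x := D.Y 4) (by decide) (by decide) (by decide) ⟨?_, ?_⟩ ⟨?_, ?_⟩
      ⟨?_, ?_⟩ ⟨?_, ?_⟩ (by rwa [R (by decide)]) <;> linarith
  have s5 : D.Y 5 ^ 2 < D.g 1 12 (D.Y 5) := by
    rw [← R (u := 4) (v := 5) (by decide)]
    refine D.edge_lt_of_lt (x := D.Y 4) (by decide) (by decide) (by decide) ⟨?_, ?_⟩ ⟨?_, ?_⟩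
      ⟨?_, ?_⟩ ⟨?_, ?_⟩ (by rwa [L (by decide)]) <;> linarith
  have s8 : D.g 1 12 (D.Y 8) < D.Y 8 ^ 2 := by
    rw [← L (u := 8) (v := 9) (by decide)]
    refine D.edge_lt_of_lt (x := D.Y 9) (by decide) (by decide) (by decide) ⟨?_, ?_⟩ ⟨?_, ?_⟩
      ⟨?_, ?_⟩ ⟨?_, ?_⟩ (by rwa [R (by decide)]) <;> linarith
  have s7 : D.g 1 12 (D.Y 7) < D.Y 7 ^ 2 := by
    rw [← L (u := 7) (v := 8) (by decide)]
    refine D.edge_lt_of_lt (x := D.Y 8) (by decide) (by decide) (by decide) ⟨?_, ?_⟩ ⟨?_, ?_⟩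
      ⟨?_, ?_⟩ ⟨?_, ?_⟩ (by rwa [R (by decide)]) <;> linarith
  exact ⟨⟨s3, s5⟩, s7, s8⟩

/-- The vertex `3` is to the left of two edges of its copy, since an edge joins it to the source. -/
theorem passes₁ (s3 : D.Y 3 ^ 2 < D.g 1 12 (D.Y 3)) :
    D.Y 3 ^ 2 < D.g 1 4 (D.Y 3) ∧ D.Y 3 ^ 2 < D.g 2 4 (D.Y 3) := by
  have low := D.low
  have high := D.high
  have m2 := D.mid 2 (by decide) (by decide) (by decide)
  have m3 := D.mid 3 (by decide) (by decide) (by decide)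
  have m4 := D.mid 4 (by decide) (by decide) (by decide)
  have y01 := D.lt_of_adj 0 1 (by decide)
  have y23 := D.lt_of_adj 2 3 (by decide)
  have y34 := D.lt_of_adj 3 4 (by decide)
  have L : ∀ {u v}, CoreAdj u v → D.g u v (D.Y u) = D.Y u ^ 2 := fun h => (IsCurve.edge h).left
  have R : ∀ {u v}, CoreAdj u v → D.g u v (D.Y v) = D.Y v ^ 2 := fun h => (IsCurve.edge h).right
  have t3 : D.g 0 3 (D.Y 1) < D.Y 1 ^ 2 := by
    rw [← L (u := 1) (v := 12) (by decide)]
    refine D.edge_lt_of_lt (x := D.Y 3) (by decide) (by decide) (by decide) ⟨?_, ?_⟩ ⟨?_, ?_⟩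
      ⟨?_, ?_⟩ ⟨?_, ?_⟩ (by rwa [R (by decide)]) <;> linarith
  have p14 : D.Y 3 ^ 2 < D.g 1 4 (D.Y 3) := by
    rw [← R (u := 0) (v := 3) (by decide)]
    refine D.edge_lt_of_lt (x := D.Y 1) (by decide) (by decide) (by decide) ⟨?_, ?_⟩ ⟨?_, ?_⟩
      ⟨?_, ?_⟩ ⟨?_, ?_⟩ (by rwa [L (u := 1) (by decide)]) <;> linarith
  have q2 : D.g 0 3 (D.Y 2) < D.Y 2 ^ 2 := by
    rw [← R (u := 1) (v := 2) (by decide)]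
    refine D.edge_lt_of_lt (x := D.Y 1) (by decide) (by decide) (by decide) ⟨?_, ?_⟩ ⟨?_, ?_⟩
      ⟨?_, ?_⟩ ⟨?_, ?_⟩ (by rwa [L (u := 1) (by decide)]) <;> linarith
  have p24 : D.Y 3 ^ 2 < D.g 2 4 (D.Y 3) := by
    rw [← R (u := 0) (v := 3) (by decide)]
    refine D.edge_lt_of_lt (x := D.Y 2) (by decide) (by decide) (by decide) ⟨?_, ?_⟩ ⟨?_, ?_⟩
      ⟨?_, ?_⟩ ⟨?_, ?_⟩ (by rwa [L (u := 2) (by decide)]) <;> linarith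
  exact ⟨p14, p24⟩

/-- The vertex `5` is to the left of two edges of its copy, since an edge joins it to the source. -/
theorem passes₂ (s5 : D.Y 5 ^ 2 < D.g 1 12 (D.Y 5)) :
    D.Y 5 ^ 2 < D.g 4 6 (D.Y 5) ∧ D.Y 5 ^ 2 < D.g 4 12 (D.Y 5) := by
  have low := D.low
  have high := D.high
  have m4 := D.mid 4 (by decide) (by decide) (by decide)
  have m5 := D.mid 5 (by decide) (by decide) (by decide)
  have m6 := D.mid 6 (by decide) (by decide) (by decide)
  have y01 := D.lt_of_adj 0 1 (by decide)
  have y45 := D.lt_of_adj 4 5 (by decide)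
  have y56 := D.lt_of_adj 5 6 (by decide)
  have L : ∀ {u v}, CoreAdj u v → D.g u v (D.Y u) = D.Y u ^ 2 := fun h => (IsCurve.edge h).left
  have R : ∀ {u v}, CoreAdj u v → D.g u v (D.Y v) = D.Y v ^ 2 := fun h => (IsCurve.edge h).right
  have t5 : D.g 0 5 (D.Y 1) < D.Y 1 ^ 2 := by
    rw [← L (u := 1) (v := 12) (by decide)]
    refine D.edge_lt_of_lt (x := D.Y 5) (by decide) (by decide) (by decide) ⟨?_, ?_⟩ ⟨?_, ?_⟩
      ⟨?_, ?_⟩ ⟨?_, ?_⟩ (by rwa [R (by decide)]) <;> linarith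
  have q4 : D.g 0 5 (D.Y 4) < D.Y 4 ^ 2 := by
    rw [← R (u := 1) (v := 4) (by decide)]
    refine D.edge_lt_of_lt (x := D.Y 1) (by decide) (by decide) (by decide) ⟨?_, ?_⟩ ⟨?_, ?_⟩
      ⟨?_, ?_⟩ ⟨?_, ?_⟩ (by rwa [L (u := 1) (by decide)]) <;> linarith
  have p46 : D.Y 5 ^ 2 < D.g 4 6 (D.Y 5) := by
    rw [← R (u := 0) (v := 5) (by decide)]
    refine D.edge_lt_of_lt (x := D.Y 4) (by decide) (by decide) (by decide) ⟨?_, ?_⟩ ⟨?_, ?_⟩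
      ⟨?_, ?_⟩ ⟨?_, ?_⟩ (by rwa [L (u := 4) (by decide)]) <;> linarith
  have p412 : D.Y 5 ^ 2 < D.g 4 12 (D.Y 5) := by
    rw [← R (u := 0) (v := 5) (by decide)]
    refine D.edge_lt_of_lt (x := D.Y 4) (by decide) (by decide) (by decide) ⟨?_, ?_⟩ ⟨?_, ?_⟩
      ⟨?_, ?_⟩ ⟨?_, ?_⟩ (by rwa [L (u := 4) (by decide)]) <;> linarith
  exact ⟨p46, p412⟩

/-- There is no one-bend drawing in which the first copy is to the left of the edge `1 → 12`. The
second copy is to the right of this edge, so that the edge passes to the left of `7` and `8`, and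
goes far to the left between them. But whatever the position of `7` and `8` among the vertices of
the first copy is, some edge of this copy is farther to the left, while being unable to go that
far: it passes to the right of the vertex `3` or `5`. -/
theorem false_of_left (h4 : D.Y 4 ^ 2 < D.g 1 12 (D.Y 4)) (h9 : D.g 1 12 (D.Y 9) < D.Y 9 ^ 2) :
    False := by
  have low := D.low
  have high := D.high
  have m2 := D.mid 2 (by decide) (by decide) (by decide)
  have m3 := D.mid 3 (by decide) (by decide) (by decide)
  have m4 := D.mid 4 (by decide) (by decide) (by decide)
  have m5 := D.mid 5 (by decide) (by decide) (by decide)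
  have m6 := D.mid 6 (by decide) (by decide) (by decide)
  have m7 := D.mid 7 (by decide) (by decide) (by decide)
  have m8 := D.mid 8 (by decide) (by decide) (by decide)
  have g23 := D.gap 2 3 (by decide) (by decide) (by decide) (D.lt_of_adj 2 3 (by decide))
  have g34 := D.gap 3 4 (by decide) (by decide) (by decide) (D.lt_of_adj 3 4 (by decide))
  have g45 := D.gap 4 5 (by decide) (by decide) (by decide) (D.lt_of_adj 4 5 (by decide))
  have g56 := D.gap 5 6 (by decide) (by decide) (by decide) (D.lt_of_adj 5 6 (by decide))
  have g78 := D.gap 7 8 (by decide) (by decide) (by decide) (D.lt_of_adj 7 8 (by decide))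
  have L : ∀ {u v}, CoreAdj u v → D.g u v (D.Y u) = D.Y u ^ 2 := fun h => (IsCurve.edge h).left
  have R : ∀ {u v}, CoreAdj u v → D.g u v (D.Y v) = D.Y v ^ 2 := fun h => (IsCurve.edge h).right
  have hB := D.oneBend 1 12 (by decide)
  obtain ⟨⟨s3, s5⟩, s7, s8⟩ := D.sides h4 h9
  obtain ⟨p14, p24⟩ := D.passes₁ s3
  obtain ⟨p46, p412⟩ := D.passes₂ s5
  have far := hB.far_left low high m7.1 g78 m8.2 s7 s8
  -- no vertex of the first copy has a height between those of `7` and `8`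
  have out : ∀ w, w ≠ 0 → w ≠ 1 → w ≠ 7 → w ≠ 8 → w ≠ 12 → D.Y w ^ 2 < D.g 1 12 (D.Y w) →
      D.Y w ≤ D.Y 7 ∨ D.Y 8 ≤ D.Y w := by
    intro w h0 h1 h7 h8 h12 hw
    by_contra! hc
    exact hB.not_left_right_left (by linarith) hc.1 hc.2 (by linarith) s7 hw s8
  set m := (D.Y 7 + D.Y 8) / 2 with hm
  rcases out 3 (by decide) (by decide) (by decide) (by decide) (by decide) s3 with o3 | o3
  swap
  · have hA := (D.oneBend 1 4 (by decide)).bounded_below m4.2 (by nlinarith) (by positivity)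
      (by positivity) (γ := D.Y 3) (m := m) g34 (by linarith) (by linarith) (by linarith)
      ((sq_nonneg _).trans p14.le)
    have hAB : D.g 1 4 m < D.g 1 12 m := by
      refine (IsCurve.edge (D := D) (u := 1) (v := 4) (by decide)).lt_of_lt
        (IsCurve.edge (D := D) (u := 1) (v := 12) (by decide)) (by decide)
        (α := m) (β := D.Y 4) (x := D.Y 4) (by linarith) (by linarith) le_rfl (by linarith) ?_
        ⟨by linarith, le_rfl⟩ ⟨le_rfl, by linarith⟩ (by rwa [R (by decide)])
      intro w hw
      obtain rfl : w = 1 :=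
        (by decide : ∀ w, w ∈ ({1, 4} : Finset (Fin 13)) ∩ {1, 12} → w = 1) w hw
      exact Or.inl (by linarith)
    linarith
  rcases out 4 (by decide) (by decide) (by decide) (by decide) (by decide) h4 with o4 | o4
  swap
  · have hA := (D.oneBend 2 4 (by decide)).bounded_above m2.1 (by nlinarith) (by positivity)
      (by positivity) (γ := D.Y 3) (m := m) g23 (by linarith) (by linarith) (by linarith)
      ((sq_nonneg _).trans p24.le)
    have hAB : D.g 2 4 m < D.g 1 12 m := by
      refine D.edge_lt_of_lt (x := D.Y 4) (by decide) (by decide) (by decide) ⟨?_, ?_⟩ ⟨?_, ?_⟩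
        ⟨?_, ?_⟩ ⟨?_, ?_⟩ (by rwa [R (v := 4) (by decide)]) <;> linarith
    linarith
  rcases out 5 (by decide) (by decide) (by decide) (by decide) (by decide) s5 with o5 | o5
  swap
  · have hA := (D.oneBend 4 6 (by decide)).bounded_below m6.2 (by nlinarith) (by positivity)
      (by positivity) (γ := D.Y 5) (m := m) g56 (by linarith) (by linarith) (by linarith)
      ((sq_nonneg _).trans p46.le)
    have hAB : D.g 4 6 m < D.g 1 12 m := by
      refine D.edge_lt_of_lt (x := D.Y 4) (by decide) (by decide) (by decide) ⟨?_, ?_⟩ ⟨?_, ?_⟩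
        ⟨?_, ?_⟩ ⟨?_, ?_⟩ (by rwa [L (u := 4) (by decide)]) <;> linarith
    linarith
  · have hA := (D.oneBend 4 12 (by decide)).bounded_above m4.1 (by nlinarith) (by positivity)
      (by positivity) (γ := D.Y 5) (m := m) g45 (by linarith) (by linarith) (by linarith)
      ((sq_nonneg _).trans p412.le)
    have hAB : D.g 4 12 m < D.g 1 12 m := by
      refine (IsCurve.edge (D := D) (u := 4) (v := 12) (by decide)).lt_of_lt
        (IsCurve.edge (D := D) (u := 1) (v := 12) (by decide)) (by decide)
        (α := D.Y 4) (β := m) (x := D.Y 4) le_rfl (by linarith) (by linarith) (by linarith) ?_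
        ⟨le_rfl, by linarith⟩ ⟨by linarith, le_rfl⟩ (by rwa [L (by decide)])
      intro w hw
      obtain rfl : w = 12 :=
        (by decide : ∀ w, w ∈ ({4, 12} : Finset (Fin 13)) ∩ {1, 12} → w = 12) w hw
      exact Or.inr (by linarith)
    linarith

theorem isEmpty : IsEmpty CoreDrawing := by
  refine ⟨fun D => ?_⟩
  rcases D.separated with h | h
  · exact D.false_of_left h.1 h.2
  · exact D.swap.false_of_left h.1 h.2

end CoreDrawing

/-! ### Edges of an upward drawing as functions of the height -/

section EdgeFunctions

variable {V : Type*} {G : Digraph V} {Γ : PlanarDrawing G}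

theorem PlanarDrawing.IsUpward.lt (hΓ : Γ.IsUpward) {u v : V} (h : G.Adj u v) :
    (Γ.pos u).2 < (Γ.pos v).2 := by
  have := hΓ u v h (show (0 : unitInterval) < 1 from zero_lt_one)
  simpa using this

theorem PlanarDrawing.IsUpward.eq_of_snd_eq (hΓ : Γ.IsUpward) {u v : V} (h : G.Adj u v)
    {p q : Plane} (hp : p ∈ range (Γ.arc u v h)) (hq : q ∈ range (Γ.arc u v h))
    (e : p.2 = q.2) : p = q := by
  obtain ⟨σ, rfl⟩ := hp
  obtain ⟨τ, rfl⟩ := hq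
  rw [(hΓ u v h).injective e]

theorem PlanarDrawing.IsUpward.snd_mem (hΓ : Γ.IsUpward) {u v : V} (h : G.Adj u v)
    {p : Plane} (hp : p ∈ range (Γ.arc u v h)) : p.2 ∈ Icc (Γ.pos u).2 (Γ.pos v).2 := by
  obtain ⟨σ, rfl⟩ := hp
  constructor
  · have := (hΓ u v h).monotone (show (0 : unitInterval) ≤ σ from unitInterval.nonneg')
    simpa using this
  · have := (hΓ u v h).monotone (show σ ≤ (1 : unitInterval) from unitInterval.le_one')
    simpa using this

/-- An upward edge meets every horizontal line between its ends, by the intermediate value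
theorem. -/
theorem PlanarDrawing.exists_mem_arc (Γ : PlanarDrawing G) {u v : V} (h : G.Adj u v) {y : ℝ}
    (hy : y ∈ Icc (Γ.pos u).2 (Γ.pos v).2) : ∃ x, (x, y) ∈ range (Γ.arc u v h) := by
  have hc : Continuous fun τ => (Γ.arc u v h τ).2 := by fun_prop
  obtain ⟨τ, -, hτ⟩ := isPreconnected_univ.intermediate_value₂ (mem_univ (0 : unitInterval))
    (mem_univ 1) hc.continuousOn (continuousOn_const (c := y)) (by simpa using hy.1)
    (by simpa using hy.2)
  exact ⟨(Γ.arc u v h τ).1, τ, Prod.ext rfl hτ⟩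

/-- A point of a segment that is not horizontal, from its height. -/
theorem mem_segment_of_height {p q : Plane} {y : ℝ} (h : p.2 < q.2) (hy : y ∈ Icc p.2 q.2) :
    (p.1 + (q.1 - p.1) / (q.2 - p.2) * (y - p.2), y) ∈ segment ℝ p q := by
  have h' : q.2 - p.2 ≠ 0 := by linarith
  rw [segment_eq_image_lineMap]
  refine ⟨(y - p.2) / (q.2 - p.2), ⟨div_nonneg (by linarith [hy.1]) (by linarith),
    (div_le_one (by linarith)).2 (by linarith [hy.2])⟩, ?_⟩
  rw [AffineMap.lineMap_apply]
  ext
  · simp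
    ring
  · simp
    field_simp
    ring

theorem exists_oneBend {S : Finset Plane} (hΓ : IsUPSE Γ S 1) {u v : V} (h : G.Adj u v) :
    ∃ g : ℝ → ℝ, (∀ y ∈ Icc (Γ.pos u).2 (Γ.pos v).2, (g y, y) ∈ range (Γ.arc u v h)) ∧
      OneBend g (Γ.pos u).2 (Γ.pos u).1 (Γ.pos v).2 (Γ.pos v).1 := by
  have hup := hΓ.upward
  choose! g hg using fun y hy => Γ.exists_mem_arc h (y := y) hy
  refine ⟨g, hg, ?_⟩
  have huv := hup.lt h
  -- a segment without a bend is treated as having a bend at its upper end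
  obtain ⟨q, hq, hs1, hs2⟩ : ∃ q ∈ range (Γ.arc u v h),
      segment ℝ (Γ.pos u) q ⊆ range (Γ.arc u v h) ∧
      segment ℝ q (Γ.pos v) ⊆ range (Γ.arc u v h) := by
    obtain ⟨l, hl, e⟩ := hΓ.bends u v h
    match l, hl with
    | [], _ =>
      have hv : Γ.pos v ∈ range (Γ.arc u v h) := ⟨1, by simp⟩
      refine ⟨Γ.pos v, hv, ?_, ?_⟩
      · rw [e]
        exact subset_union_left
      · rw [segment_same]
        exact singleton_subset_iff.2 hv
    | [q], _ =>
      have h2 : segment ℝ q (Γ.pos v) ⊆ range (Γ.arc u v h) := by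
        rw [e]
        exact subset_union_left.trans subset_union_right
      refine ⟨q, h2 (left_mem_segment ℝ _ _), ?_, h2⟩
      rw [e]
      exact subset_union_left
  have hqI := hup.snd_mem h hq
  have hu : Γ.pos u ∈ range (Γ.arc u v h) := ⟨0, by simp⟩
  have hv : Γ.pos v ∈ range (Γ.arc u v h) := ⟨1, by simp⟩
  refine ⟨q.2, hqI, (q.1 - (Γ.pos u).1) / (q.2 - (Γ.pos u).2),
    ((Γ.pos v).1 - q.1) / ((Γ.pos v).2 - q.2), fun y hy => ?_, fun y hy => ?_⟩
  · have hgy := hg y ⟨hy.1, hy.2.trans hqI.2⟩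
    rcases hqI.1.eq_or_lt with h0 | h0
    · have hy0 : y = (Γ.pos u).2 := le_antisymm (hy.2.trans h0.ge) hy.1
      have := congrArg Prod.fst (hup.eq_of_snd_eq h hgy hu hy0)
      simpa [hy0] using this
    · exact congrArg Prod.fst
        (hup.eq_of_snd_eq h hgy (hs1 (mem_segment_of_height h0 hy)) rfl)
  · have hgy := hg y ⟨hqI.1.trans hy.1, hy.2⟩
    rcases hqI.2.eq_or_lt with h0 | h0
    · have hy0 : y = (Γ.pos v).2 := le_antisymm hy.2 (h0.ge.trans hy.1)
      have := congrArg Prod.fst (hup.eq_of_snd_eq h hgy hv hy0)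
      simpa [hy0] using this
    · refine (congrArg Prod.fst
        (hup.eq_of_snd_eq h hgy (hs2 (mem_segment_of_height h0 hy)) rfl)).trans ?_
      have h' : (Γ.pos v).2 - q.2 ≠ 0 := by linarith
      simp only
      field_simp
      ring

end EdgeFunctions

/-! ### The digraph and the point set -/

/-- The `n`-vertex digraph: the core digraph, and a directed path `12 → 13 → ⋯ → n - 1`. -/
def digraph (n : ℕ) : Digraph (Fin n) where
  Adj u v := (u.val, v.val) ∈ coreEdges ∨ 12 ≤ u.val ∧ v.val = u.val + 1

/-- The heights of the points: `-10001`, `-10000`, then `1, …, 10`, then `10012, 10013, …`. -/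
def height (i : ℕ) : ℝ :=
  if i < 2 then i - 10001 else if i < 12 then i - 1 else 10000 + i

/-- The points of the parabola `x = y ^ 2` at the first `n` heights. -/
noncomputable def pointSet (n : ℕ) : Finset Plane :=
  (Finset.range n).image fun i => (height i ^ 2, height i)

theorem height_add_one_le {i j : ℕ} (h : i < j) : height i + 1 ≤ height j := by
  have : (i : ℝ) + 1 ≤ j := by exact_mod_cast h
  unfold height
  split_ifs with h1 h2 h3 h4 h5 h6 <;> first | omega | skip
  · linarith
  · have : (i : ℝ) < 2 := by exact_mod_cast h1
    have : (0 : ℝ) ≤ j := by positivity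
    linarith
  · have : (0 : ℝ) ≤ j := by positivity
    linarith
  · linarith
  · linarith
  · linarith

theorem height_strictMono : StrictMono height :=
  fun _ _ h => (lt_add_one _).trans_le (height_add_one_le h)

theorem adj_of_mem {n : ℕ} {i j : ℕ} (hi : i < n) (hj : j < n) (h : (i, j) ∈ coreEdges) :
    (digraph n).Adj ⟨i, hi⟩ ⟨j, hj⟩ := Or.inl h

theorem coreEdges_lt : ∀ e ∈ coreEdges, e.1 < e.2 ∧ e.2 ≤ 12 := by decide

theorem lt_of_adj {n : ℕ} {u v : Fin n} (h : (digraph n).Adj u v) : u < v := by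
  rcases h with h | h
  · exact (coreEdges_lt _ h).1
  · exact Fin.lt_def.2 (by omega)

/-! ### Positions of the core vertices in a point-set embedding -/

theorem exists_pred : ∀ j < 13, 2 ≤ j → ∃ i < j, 1 ≤ i ∧ (i, j) ∈ coreEdges := by decide

theorem exists_succ : ∀ i < 12, ∃ j < 13, i < j ∧ (i, j) ∈ coreEdges := by decide

/-- In an ordering of all the vertices along the edges, the vertices `0`, `1` and `12` have these
numbers as their ranks. -/
theorem rank_eq {n : ℕ} (hn : 13 ≤ n) (r : Fin n → Fin n) (hr : Function.Injective r)
    (hlt : ∀ u v, (digraph n).Adj u v → r u < r v) :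
    (r ⟨0, by omega⟩).val = 0 ∧ (r ⟨1, by omega⟩).val = 1 ∧ (r ⟨12, by omega⟩).val = 12 := by
  have hs : Function.Surjective r := Finite.injective_iff_surjective.1 hr
  have h01 : r ⟨0, by omega⟩ < r ⟨1, by omega⟩ :=
    hlt _ _ (adj_of_mem (by omega) (by omega) (by decide))
  have h1 : ∀ j (hj : j < n), 2 ≤ j → r ⟨1, by omega⟩ < r ⟨j, hj⟩ := by
    intro j
    induction j using Nat.strong_induction_on with
    | _ j ih =>
      intro hj h2
      obtain ⟨i, hij, hi1, hadj⟩ : ∃ i, ∃ h : i < j, 1 ≤ i ∧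
          (digraph n).Adj ⟨i, h.trans hj⟩ ⟨j, hj⟩ := by
        by_cases h13 : j < 13
        · obtain ⟨i, h, hi1, he⟩ := exists_pred j h13 h2
          exact ⟨i, h, hi1, adj_of_mem _ _ he⟩
        · exact ⟨j - 1, by omega, by omega, Or.inr ⟨by simp; omega, by simp; omega⟩⟩
      have := hlt _ _ hadj
      rcases hi1.eq_or_lt with rfl | hi2
      · exact this
      · exact (ih i hij (hij.trans hj) hi2).trans this
  have h12 : ∀ k i (hi : i < 12), 12 - i ≤ k → r ⟨i, by omega⟩ < r ⟨12, by omega⟩ := by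
    intro k
    induction k with
    | zero =>
      intro i hi hk
      omega
    | succ k ih =>
      intro i hi hk
      obtain ⟨j, hj, hij, he⟩ := exists_succ i hi
      have := hlt _ _ (adj_of_mem (n := n) (by omega) (by omega) he)
      rcases (Nat.lt_succ_iff.1 hj).eq_or_lt with rfl | hj2
      · exact this
      · exact this.trans (ih j hj2 (by omega))
  have htop : ∀ k (hk : 12 + k < n), (r ⟨12, by omega⟩).val + k ≤ (r ⟨12 + k, hk⟩).val := by
    intro k
    induction k with
    | zero =>
      intro hk
      exact le_rfl
    | succ k ih =>
      intro hk
      have h1 := ih (by omega)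
      have h2 := Fin.lt_def.1 (hlt ⟨12 + k, by omega⟩ ⟨12 + (k + 1), hk⟩
        (Or.inr ⟨by simp, by simp; omega⟩))
      omega
  rw [Fin.lt_def] at h01
  have hv : ∀ w : Fin n, w.val = 0 ∧ (r w).val = (r ⟨0, by omega⟩).val ∨
      w.val = 1 ∧ (r w).val = (r ⟨1, by omega⟩).val ∨ (r ⟨1, by omega⟩).val < (r w).val := by
    rintro ⟨w, hw⟩
    by_cases h0 : w = 0
    · subst h0
      exact Or.inl ⟨rfl, rfl⟩
    by_cases h1' : w = 1
    · subst h1'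
      exact Or.inr (Or.inl ⟨rfl, rfl⟩)
    · exact Or.inr (Or.inr (Fin.lt_def.1 (h1 w hw (by omega))))
  have r0 : (r ⟨0, by omega⟩).val = 0 := by
    obtain ⟨w, hw⟩ := hs ⟨0, by omega⟩
    have hwv : (r w).val = 0 := by rw [hw]
    rcases hv w with h | h | h <;> omega
  refine ⟨r0, ?_, le_antisymm ?_ ?_⟩
  · obtain ⟨w, hw⟩ := hs ⟨1, by omega⟩
    have hwv : (r w).val = 1 := by rw [hw]
    rcases hv w with h | h | h <;> omega
  · have h1 := htop (n - 13) (by omega)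
    have h2 := (r ⟨12 + (n - 13), by omega⟩).isLt
    omega
  · have := Finset.card_le_card_of_injOn (s := Finset.univ (α := Fin 12))
      (t := Finset.range (r ⟨12, by omega⟩).val) (fun i => (r ⟨i.val, by omega⟩).val)
      (fun i _ => by
        simp only [Finset.coe_range, mem_Iio]
        exact h12 12 i.val i.isLt (by omega))
      (fun i _ j _ e => Fin.ext (by simpa using hr (Fin.ext e)))
    simpa using this

/-- A one-bend embedding of the digraph on the point set gives a drawing of the core digraph with
remote vertices `1` and `12`. -/
theorem not_admitsUPSE {n : ℕ} (hn : 13 ≤ n) : ¬ AdmitsUPSE (digraph n) (pointSet n) 1 := by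
  rintro ⟨Γ, hΓ⟩
  have hpos : ∀ v, ∃ i : Fin n, Γ.pos v = (height i ^ 2, height i) := by
    intro v
    have hv : Γ.pos v ∈ (pointSet n : Set Plane) := hΓ.range_pos ▸ mem_range_self v
    simp only [pointSet, Finset.coe_image, Finset.coe_range, mem_image, mem_Iio] at hv
    obtain ⟨i, hi, e⟩ := hv
    exact ⟨⟨i, hi⟩, e.symm⟩
  choose r hr using hpos
  have hlt : ∀ u v, (digraph n).Adj u v → r u < r v := by
    intro u v h
    have := hΓ.upward.lt h
    rw [hr, hr] at this
    exact height_strictMono.lt_iff_lt.1 this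
  have hinj : Function.Injective r := by
    intro u v e
    apply Γ.pos_injective
    rw [hr, hr, e]
  obtain ⟨r0, r1, r12⟩ := rank_eq hn r hinj hlt
  let c : Fin 13 → Fin n := fun i => ⟨i.val, by omega⟩
  have hc : Function.Injective c := fun i j e => Fin.ext (by simpa [c] using e)
  have hadj : ∀ {u v}, CoreAdj u v → (digraph n).Adj (c u) (c v) := fun h => Or.inl h
  have hrc : ∀ u v, CoreAdj u v → r (c u) < r (c v) := fun u v h => hlt _ _ (hadj h)
  have hne : ∀ {v w}, v ≠ w → (r (c v)).val ≠ (r (c w)).val :=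
    fun h e => h (hc (hinj (Fin.ext e)))
  have h12 : ∀ v, v ≠ 12 → (r (c v)).val < 12 := by
    have : ∀ k (v : Fin 13), 12 - v.val ≤ k → v ≠ 12 → (r (c v)).val < 12 := by
      intro k
      induction k with
      | zero =>
        intro v hk hv
        exact absurd (Fin.ext (by have := v.isLt; simp; omega)) hv
      | succ k ih =>
        intro v hk hv
        have hv' : v.val < 12 := by
          have := v.isLt
          have : v.val ≠ 12 := fun h => hv (Fin.ext h)
          omega
        obtain ⟨j, hj, hij, he⟩ := exists_succ v.val hv'
        have h := Fin.lt_def.1 (hrc v ⟨j, hj⟩ he)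
        by_cases hj12 : (⟨j, hj⟩ : Fin 13) = 12
        · rw [hj12] at h
          exact h.trans_eq r12
        · exact h.trans (ih ⟨j, hj⟩ (by simp; omega) hj12)
    exact fun v => this 12 v (by omega)
  have h2 : ∀ v, v ≠ 0 → v ≠ 1 → 2 ≤ (r (c v)).val := by
    intro v h0 h1
    have e0 := hne h0
    have e1 := hne h1
    have r0' : (r (c 0)).val = 0 := r0
    have r1' : (r (c 1)).val = 1 := r1
    omega
  have hg : ∀ u v, ∃ g : ℝ → ℝ, CoreAdj u v →
      (∀ y ∈ Icc (Γ.pos (c u)).2 (Γ.pos (c v)).2, ∀ h, (g y, y) ∈ range (Γ.arc (c u) (c v) h)) ∧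
      OneBend g (Γ.pos (c u)).2 (Γ.pos (c u)).1 (Γ.pos (c v)).2 (Γ.pos (c v)).1 := by
    intro u v
    by_cases h : CoreAdj u v
    · obtain ⟨g, h1, h2⟩ := exists_oneBend hΓ (hadj h)
      exact ⟨g, fun _ => ⟨fun y hy _ => h1 y hy, h2⟩⟩
    · exact ⟨0, fun h' => absurd h' h⟩
  choose g hg using hg
  refine CoreDrawing.isEmpty.false
    { Y := fun v => height (r (c v))
      g := g
      lt_of_adj := fun u v h => height_strictMono (hrc u v h)
      low := ?_
      high := ?_
      mid := ?_
      gap := ?_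
      oneBend := ?_
      meet := ?_ }
  · have : (r (c 1)).val = 1 := r1
    rw [this]
    norm_num [height]
  · have : (r (c 12)).val = 12 := r12
    rw [this]
    norm_num [height]
  · intro v h0 h1 hv
    have a := h2 v h0 h1
    have b := h12 v hv
    have a' : (2 : ℝ) ≤ ((r (c v)).val : ℝ) := by exact_mod_cast a
    have b' : ((r (c v)).val : ℝ) ≤ 11 := by exact_mod_cast Nat.lt_succ_iff.1 b
    rw [height, if_neg (by omega), if_pos b]
    constructor <;> linarith
  · intro u v _ _ _ h
    exact height_add_one_le (height_strictMono.lt_iff_lt.1 h)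
  · intro u v h
    have := (hg u v h).2
    rwa [hr, hr] at this
  · intro u v u' v' h h' hne' y hy hy' e
    have m1 := (hg u v h).1 y (by rw [hr, hr]; exact hy) (hadj h)
    have m2 := (hg u' v' h').1 y (by rw [hr, hr]; exact hy') (hadj h')
    rw [← e] at m2
    obtain ⟨w, hw⟩ := Γ.arc_inter_arc _ _ (hadj h) _ _ (hadj h')
      (fun e => hne' (by
        rw [Prod.mk.injEq] at e ⊢
        exact ⟨hc e.1, hc e.2⟩)) ⟨m1, m2⟩
    rw [← hw] at m1 m2
    have hwy : height (r w) = y := by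
      have := congrArg Prod.snd hw
      rwa [hr] at this
    have v1 := Γ.vertex_on_arc _ _ _ w m1
    have v2 := Γ.vertex_on_arc _ _ _ w m2
    rcases v1 with rfl | rfl
    · exact ⟨u, Or.inl rfl, v2.imp (fun h => hc h) (fun h => hc h), hwy⟩
    · exact ⟨v, Or.inr rfl, v2.imp (fun h => hc h) (fun h => hc h), hwy⟩

/-! ### The digraph is an `st`-digraph -/

theorem isStDigraph {n : ℕ} (hn : 13 ≤ n) : IsStDigraph (digraph n) where
  acyclic v h := by
    have : ∀ {u w : Fin n}, Relation.TransGen (digraph n).Adj u w → u < w := by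
      intro u w h
      induction h with
      | single h => exact lt_of_adj h
      | tail _ h ih => exact ih.trans (lt_of_adj h)
    exact lt_irrefl _ (this h)
  single_source := by
    refine ⟨⟨0, by omega⟩, fun v h => absurd (lt_of_adj h) (by simp [Fin.lt_def]), ?_⟩
    rintro ⟨w, hw⟩ h
    by_contra hne
    have h0 : w ≠ 0 := fun e => hne (Fin.ext e)
    by_cases h13 : w < 13
    · rcases (show w = 1 ∨ 2 ≤ w by omega) with rfl | h2
      · exact h ⟨0, by omega⟩ (Or.inl (show (0, 1) ∈ coreEdges by decide))
      · obtain ⟨i, hi, -, he⟩ := exists_pred w h13 h2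
        exact h ⟨i, hi.trans hw⟩ (Or.inl he)
    · exact h ⟨w - 1, by omega⟩ (Or.inr ⟨by simp; omega, by simp; omega⟩)
  single_sink := by
    refine ⟨⟨n - 1, by omega⟩, fun v h => absurd (lt_of_adj h) ?_, ?_⟩
    · have := v.isLt
      rw [Fin.lt_def]
      simp only
      omega
    · rintro ⟨w, hw⟩ h
      by_contra hne
      have h1 : w ≠ n - 1 := fun e => hne (Fin.ext e)
      by_cases h12 : w < 12
      · obtain ⟨j, hj, -, he⟩ := exists_succ w h12
        exact h ⟨j, by omega⟩ (Or.inl he)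
      · exact h ⟨w + 1, by omega⟩ (Or.inr ⟨by simp; omega, by simp⟩)

/-! ### The point set is upward one-sided convex -/

theorem card_pointSet (n : ℕ) : (pointSet n).card = n := by
  rw [pointSet, Finset.card_image_of_injective, Finset.card_range]
  intro i j e
  exact height_strictMono.injective (congrArg Prod.snd e)

theorem mem_pointSet {n : ℕ} {p : Plane} :
    p ∈ pointSet n ↔ ∃ i < n, p = (height i ^ 2, height i) := by
  simp only [pointSet, Finset.mem_image, Finset.mem_range]
  exact ⟨fun ⟨i, h, e⟩ => ⟨i, h, e.symm⟩, fun ⟨i, h, e⟩ => ⟨i, h, e.symm⟩⟩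

theorem convex_lt_halfPlane (c d : ℝ) : Convex ℝ {p : Plane | c * p.2 + d < p.1} := by
  intro p hp q hq a b ha hb hab
  simp only [mem_ofPred_eq, Prod.snd_add, Prod.smul_snd, smul_eq_mul, Prod.fst_add,
    Prod.smul_fst] at *
  obtain rfl : b = 1 - a := by linarith
  rcases ha.eq_or_lt with rfl | ha'
  · linarith
  · nlinarith

theorem convex_halfPlane (c d : ℝ) : Convex ℝ {p : Plane | p.1 ≤ c * p.2 + d} := by
  intro p hp q hq a b ha hb hab
  simp only [mem_ofPred_eq, Prod.snd_add, Prod.smul_snd, smul_eq_mul, Prod.fst_add,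
    Prod.smul_fst] at *
  obtain rfl : b = 1 - a := by linarith
  nlinarith

theorem isUOSC_pointSet {n : ℕ} (hn : 2 ≤ n) : IsUOSC (pointSet n) where
  convex_position := by
    intro p hp hmem
    obtain ⟨i, hi, rfl⟩ := mem_pointSet.1 hp
    -- the tangent of the parabola at a point leaves the other points strictly on one side
    have hsub : (pointSet n : Set Plane) \ {(height i ^ 2, height i)} ⊆
        {q : Plane | 2 * height i * q.2 + -(height i ^ 2) < q.1} := by
      rintro q ⟨hq, hne⟩
      obtain ⟨j, hj, rfl⟩ := mem_pointSet.1 hq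
      have hij : height j - height i ≠ 0 := by
        intro h
        apply hne
        rw [mem_singleton_iff, show height j = height i by linarith]
      have := sq_pos_of_ne_zero hij
      simp only [mem_ofPred_eq]
      nlinarith
    have := convexHull_min hsub (convex_lt_halfPlane _ _) hmem
    simp only [mem_ofPred_eq] at this
    nlinarith
  heights_distinct := by
    intro p hp q hq e
    obtain ⟨i, hi, rfl⟩ := mem_pointSet.1 hp
    obtain ⟨j, hj, rfl⟩ := mem_pointSet.1 hq
    simp only at e
    rw [e]
  one_sided := by
    have hb : ((height 0 ^ 2, height 0) : Plane) ∈ pointSet n := mem_pointSet.2 ⟨0, by omega, rfl⟩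
    have ht : ((height (n - 1) ^ 2, height (n - 1)) : Plane) ∈ pointSet n :=
      mem_pointSet.2 ⟨n - 1, by omega, rfl⟩
    have hbetween : ∀ i < n, height 0 ≤ height i ∧ height i ≤ height (n - 1) := fun i hi =>
      ⟨height_strictMono.monotone (by omega), height_strictMono.monotone (by omega)⟩
    refine ⟨_, hb, _, ht, ?_, ?_, ?_⟩
    · intro p hp
      obtain ⟨i, hi, rfl⟩ := mem_pointSet.1 hp
      exact hbetween i hi
    · -- the hull lies in the half-plane to the left of the line through the two points
      set s := height 0
      set t := height (n - 1)
      intro p hp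
      have hpl : p.1 = (s + t) * p.2 + -(s * t) := by
        obtain ⟨a, b, ha, hb, hab, rfl⟩ := hp
        simp only [Prod.fst_add, Prod.smul_fst, smul_eq_mul, Prod.snd_add, Prod.smul_snd]
        obtain rfl : b = 1 - a := by linarith
        ring
      have hull : convexHull ℝ (pointSet n : Set Plane) ⊆
          {q : Plane | q.1 ≤ (s + t) * q.2 + -(s * t)} := by
        refine convexHull_min ?_ (convex_halfPlane _ _)
        intro q hq
        obtain ⟨i, hi, rfl⟩ := mem_pointSet.1 hq
        have := hbetween i hi
        simp only [mem_ofPred_eq]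
        nlinarith [mul_nonneg (sub_nonneg.2 this.1) (sub_nonneg.2 this.2)]
      refine ⟨subset_closure ((convex_convexHull ℝ _).segment_subset
        (subset_convexHull ℝ _ hb) (subset_convexHull ℝ _ ht) hp), fun hint => ?_⟩
      have hc : Continuous fun r : ℝ => ((p.1 + r, p.2) : Plane) := by fun_prop
      have hev := hc.continuousAt.preimage_mem_nhds (x := 0)
        (by simpa using mem_interior_iff_mem_nhds.1 hint)
      obtain ⟨ε, hε, hball⟩ := Metric.mem_nhds_iff.1 hev
      have hin : ε / 2 ∈ Metric.ball (0 : ℝ) ε := by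
        rw [Metric.mem_ball, Real.dist_eq, sub_zero, abs_of_pos (by linarith)]
        linarith
      have := hull (hball hin)
      simp only [mem_ofPred_eq] at this
      linarith
    · intro p hp hpb hpt
      obtain ⟨i, hi, rfl⟩ := mem_pointSet.1 hp
      have hb' : height 0 < height i := by
        refine lt_of_le_of_ne (hbetween i hi).1 fun e => hpb ?_
        rw [e]
      have ht' : height i < height (n - 1) := by
        refine lt_of_le_of_ne (hbetween i hi).2 fun e => hpt ?_
        rw [e]
      have := mul_pos (mul_pos (sub_pos.2 (hb'.trans ht')) (sub_pos.2 hb')) (sub_pos.2 ht')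
      unfold StrictlyLeftOf
      simp only
      linarith

/-! ### A straight-line drawing -/

/-- Twice the signed area of the triangle `p q r`. -/
def cross {R : Type*} [CommRing R] (p q r : R × R) : R :=
  (q.1 - p.1) * (r.2 - p.2) - (q.2 - p.2) * (r.1 - p.1)

theorem cross_eq_zero_of_mem_segment {p q x : Plane} (hx : x ∈ segment ℝ p q) :
    cross p q x = 0 := by
  obtain ⟨a, b, ha, hb, hab, rfl⟩ := hx
  obtain rfl : b = 1 - a := by linarith
  simp only [cross, Prod.fst_add, Prod.smul_fst, smul_eq_mul, Prod.snd_add, Prod.smul_snd]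
  ring

theorem snd_mem_of_mem_segment {p q x : Plane} (h : p.2 ≤ q.2) (hx : x ∈ segment ℝ p q) :
    p.2 ≤ x.2 ∧ x.2 ≤ q.2 := by
  obtain ⟨a, b, ha, hb, hab, rfl⟩ := hx
  obtain rfl : b = 1 - a := by linarith
  simp only [Prod.snd_add, Prod.smul_snd, smul_eq_mul]
  constructor <;> nlinarith

/-- The points `r` and `s` are on the same closed side of the line through `p` and `q`, and not
both on this line. -/
def OneSide {R : Type*} [CommRing R] [LinearOrder R] (p q r s : R × R) : Prop :=
  (0 ≤ cross p q r ∧ 0 ≤ cross p q s ∧ 0 < cross p q r + cross p q s) ∨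
    (cross p q r ≤ 0 ∧ cross p q s ≤ 0 ∧ cross p q r + cross p q s < 0)

instance (p q r s : ℤ × ℤ) : Decidable (OneSide p q r s) :=
  inferInstanceAs (Decidable (_ ∨ _))

theorem OneSide.inter_subset {p q r s : Plane} (h : OneSide p q r s) :
    segment ℝ p q ∩ segment ℝ r s ⊆ {r, s} := by
  rintro x ⟨hx1, hx2⟩
  have h0 := cross_eq_zero_of_mem_segment hx1
  obtain ⟨a, b, ha, hb, hab, rfl⟩ := hx2
  have he : a * cross p q r + b * cross p q s = 0 := by
    rw [← h0]
    obtain rfl : b = 1 - a := by linarith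
    simp only [cross, Prod.fst_add, Prod.smul_fst, smul_eq_mul, Prod.snd_add, Prod.smul_snd]
    ring
  rcases ha.eq_or_lt with rfl | ha'
  · obtain rfl : b = 1 := by linarith
    right
    simp
  rcases hb.eq_or_lt with rfl | hb'
  · obtain rfl : a = 1 := by linarith
    left
    simp
  exfalso
  rcases h with ⟨h1, h2, h3⟩ | ⟨h1, h2, h3⟩
  · nlinarith [mul_nonneg ha h1, mul_nonneg hb h2, mul_pos ha' hb']
  · nlinarith [mul_nonneg ha (neg_nonneg.2 h1), mul_nonneg hb (neg_nonneg.2 h2), mul_pos ha' hb']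

/-- Integer coordinates of the vertices. The edge `1 → 12` and the path `12 → 13 → ⋯` are on the
vertical axis, and the two copies are mirror images of each other. -/
def coord : ℕ → ℤ × ℤ
  | 0 => (1, 0)
  | 1 => (0, 6)
  | 2 => (-1, 8)
  | 3 => (-3, 10)
  | 4 => (-2, 12)
  | 5 => (-6, 14)
  | 6 => (-4, 17)
  | 7 => (1, 8)
  | 8 => (3, 10)
  | 9 => (2, 12)
  | 10 => (6, 14)
  | 11 => (4, 17)
  | i => (0, i + 8)

/-- The point of the plane at which the vertex `i` is drawn. -/
def point (i : ℕ) : Plane := ((coord i).1, (coord i).2)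

theorem cross_point (i j k : ℕ) :
    cross (point i) (point j) (point k) = (cross (coord i) (coord j) (coord k) : ℤ) := by
  simp [cross, point]

theorem oneSide_point {i j k l : ℕ} (h : OneSide (coord i) (coord j) (coord k) (coord l)) :
    OneSide (point i) (point j) (point k) (point l) := by
  unfold OneSide at *
  simp only [cross_point]
  exact_mod_cast h

theorem coord_of_le {i : ℕ} (hi : 12 ≤ i) : coord i = (0, (i : ℤ) + 8) := by
  obtain ⟨k, rfl⟩ := Nat.exists_eq_add_of_le' hi
  rfl

theorem point_of_le {i : ℕ} (hi : 12 ≤ i) : point i = (0, (i : ℝ) + 8) := by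
  simp [point, coord_of_le hi]

theorem edge_up : ∀ e ∈ coreEdges, (coord e.1).2 < (coord e.2).2 ∧ (coord e.2).2 ≤ 20 ∧
    ((coord e.2).2 = 20 → e.2 = 12) := by
  decide

theorem edges_oneSide : ∀ e ∈ coreEdges, ∀ e' ∈ coreEdges, e ≠ e' →
    OneSide (coord e.1) (coord e.2) (coord e'.1) (coord e'.2) ∨
      OneSide (coord e'.1) (coord e'.2) (coord e.1) (coord e.2) := by
  decide

theorem edge_avoids : ∀ e ∈ coreEdges, ∀ w < 13, w ≠ e.1 → w ≠ e.2 →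
    (coord w).2 < (coord e.1).2 ∨ (coord e.2).2 < (coord w).2 ∨
      cross (coord e.1) (coord e.2) (coord w) ≠ 0 := by
  decide

theorem core_low : ∀ w < 12, (coord w).2 < 20 := by decide

theorem core_injective : ∀ i < 13, ∀ j < 13, coord i = coord j → i = j := by decide

/-! ### Planarity and upwardness of the drawing -/

theorem point_injective : Function.Injective point := by
  have hc : Function.Injective coord := by
    intro i j e
    rcases lt_or_ge i 12 with hi | hi <;> rcases lt_or_ge j 12 with hj | hj
    · exact core_injective i (by omega) j (by omega) e
    · have := core_low i hi
      rw [e, coord_of_le hj] at this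
      simp only at this
      omega
    · have := core_low j hj
      rw [← e, coord_of_le hi] at this
      simp only at this
      omega
    · rw [coord_of_le hi, coord_of_le hj, Prod.mk.injEq] at e
      omega
  intro i j e
  apply hc
  rw [point, point, Prod.mk.injEq] at e
  exact Prod.ext (by exact_mod_cast e.1) (by exact_mod_cast e.2)

theorem point_snd_lt {i j : ℕ} (h : (coord i).2 < (coord j).2) : (point i).2 < (point j).2 := by
  simpa [point] using h

/-- Adjacency in the digraph, for vertices given by their numbers. -/
abbrev NatAdj (i j : ℕ) : Prop := (i, j) ∈ coreEdges ∨ 12 ≤ i ∧ j = i + 1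

theorem NatAdj.up {i j : ℕ} (h : NatAdj i j) : (point i).2 < (point j).2 := by
  rcases h with h | ⟨h, rfl⟩
  · exact point_snd_lt (edge_up _ h).1
  · rw [point_of_le h, point_of_le (by omega)]
    push_cast
    simp

/-- The drawing of the path above the vertex `12` is contained in the vertical axis. -/
theorem mem_axis {i : ℕ} (hi : 12 ≤ i) {x : Plane} (hx : x ∈ segment ℝ (point i) (point (i + 1))) :
    x.1 = 0 ∧ (i : ℝ) + 8 ≤ x.2 ∧ x.2 ≤ i + 9 := by
  have h := snd_mem_of_mem_segment (NatAdj.up (Or.inr ⟨hi, rfl⟩)).le hx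
  rw [point_of_le hi, point_of_le (i := i + 1) (by omega)] at h hx
  refine ⟨?_, h.1, ?_⟩
  · obtain ⟨a, b, -, -, -, rfl⟩ := hx
    simp
  · have := h.2
    push_cast at this
    linarith

theorem core_height_le {i j : ℕ} (h : (i, j) ∈ coreEdges) {x : Plane}
    (hx : x ∈ segment ℝ (point i) (point j)) : x.2 ≤ 20 :=
  (snd_mem_of_mem_segment (NatAdj.up (Or.inl h)).le hx).2.trans (by
    have : ((coord j).2 : ℝ) ≤ 20 := by exact_mod_cast (edge_up _ h).2.1
    simpa [point] using this)

theorem core_inter_path {i j k : ℕ} (h : (i, j) ∈ coreEdges) (hk : 12 ≤ k) {x : Plane}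
    (hx : x ∈ segment ℝ (point i) (point j)) (hx' : x ∈ segment ℝ (point k) (point (k + 1))) :
    x = point 12 := by
  have h1 := core_height_le h hx
  obtain ⟨h2, h3, -⟩ := mem_axis hk hx'
  have hk' : (12 : ℝ) ≤ k := by exact_mod_cast hk
  rw [point_of_le le_rfl]
  refine Prod.ext h2 ?_
  push_cast
  linarith

theorem eq_of_point_mem_segment {i j w : ℕ} (h : NatAdj i j)
    (hw : point w ∈ segment ℝ (point i) (point j)) : w = i ∨ w = j := by
  by_contra! hne
  rcases h with h | ⟨h, rfl⟩
  · rcases lt_or_ge w 13 with h13 | h13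
    · have hI := snd_mem_of_mem_segment (NatAdj.up (Or.inl h)).le hw
      rcases edge_avoids _ h w h13 hne.1 hne.2 with h' | h' | h'
      · exact (point_snd_lt h').not_ge hI.1
      · exact (point_snd_lt h').not_ge hI.2
      · apply h'
        have := cross_eq_zero_of_mem_segment hw
        rw [cross_point] at this
        exact_mod_cast this
    · have h1 := core_height_le h hw
      rw [point_of_le (by omega)] at h1
      have : (13 : ℝ) ≤ w := by exact_mod_cast h13
      simp only at h1
      linarith
  · obtain ⟨-, h2, h3⟩ := mem_axis h hw
    rcases lt_or_ge w 12 with h12 | h12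
    · have h4 : (point w).2 < 20 := by
        have : ((coord w).2 : ℝ) < 20 := by exact_mod_cast core_low w h12
        simpa [point] using this
      have : (12 : ℝ) ≤ i := by exact_mod_cast h
      linarith
    · rw [point_of_le h12] at h2 h3
      simp only at h2 h3
      have h4 : i ≤ w := by
        have : (i : ℝ) ≤ w := by linarith
        exact_mod_cast this
      have h5 : w ≤ i + 1 := by
        have : (w : ℝ) ≤ ((i + 1 : ℕ) : ℝ) := by
          push_cast
          linarith
        exact_mod_cast this
      omega

/-- Two edges of the straight-line drawing meet only at a common end-vertex. -/
theorem segment_inter_segment {i j k l : ℕ} (h : NatAdj i j) (h' : NatAdj k l)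
    (hne : (i, j) ≠ (k, l)) {x : Plane} (hx : x ∈ segment ℝ (point i) (point j))
    (hx' : x ∈ segment ℝ (point k) (point l)) :
    x = point i ∨ x = point j ∨ x = point k ∨ x = point l := by
  rcases h with h | ⟨h, rfl⟩ <;> rcases h' with h' | ⟨h', rfl⟩
  · rcases edges_oneSide _ h _ h' hne with hs | hs
    · rcases (oneSide_point hs).inter_subset ⟨hx, hx'⟩ with e | e
      · exact Or.inr (Or.inr (Or.inl e))
      · exact Or.inr (Or.inr (Or.inr e))
    · rcases (oneSide_point hs).inter_subset ⟨hx', hx⟩ with e | e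
      · exact Or.inl e
      · exact Or.inr (Or.inl e)
  · have e := core_inter_path h h' hx hx'
    rw [e] at hx hx'
    rcases eq_of_point_mem_segment (Or.inl h) hx with h1 | h1
    · exact Or.inl (by rw [e, h1])
    · exact Or.inr (Or.inl (by rw [e, h1]))
  · have e := core_inter_path h' h hx' hx
    rw [e] at hx hx'
    rcases eq_of_point_mem_segment (Or.inl h') hx' with h1 | h1
    · exact Or.inr (Or.inr (Or.inl (by rw [e, h1])))
    · exact Or.inr (Or.inr (Or.inr (by rw [e, h1])))
  · obtain ⟨h1, h2, h3⟩ := mem_axis h hx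
    obtain ⟨-, h4, h5⟩ := mem_axis h' hx'
    rcases lt_trichotomy i k with hik | rfl | hik
    · have : (i : ℝ) + 1 ≤ k := by exact_mod_cast hik
      refine Or.inr (Or.inr (Or.inl ?_))
      rw [point_of_le h']
      exact Prod.ext h1 (by simp only; linarith)
    · exact absurd rfl hne
    · have : (k : ℝ) + 1 ≤ i := by exact_mod_cast hik
      left
      rw [point_of_le h]
      exact Prod.ext h1 (by simp only; linarith)

/-- The straight-line drawing. -/
noncomputable def drawing (n : ℕ) : PlanarDrawing (digraph n) where
  pos v := point v
  arc u v _ := Path.segment (point u) (point v)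
  pos_injective u v e := Fin.ext (point_injective e)
  arc_injective u v h := by
    intro σ τ e
    have hne : (point u).2 < (point v).2 := NatAdj.up h
    have := congrArg Prod.snd e
    simp only [Path.segment_apply, AffineMap.lineMap_apply_module, Prod.snd_add, Prod.smul_snd,
      smul_eq_mul] at this
    refine Subtype.ext (mul_right_cancel₀ (sub_pos.2 hne).ne' ?_)
    linarith
  vertex_on_arc u v h w hw := by
    rw [Path.range_segment] at hw
    exact (eq_of_point_mem_segment h hw).imp Fin.ext Fin.ext
  arc_inter_arc u v h u' v' h' hne := by
    rintro x ⟨hx, hx'⟩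
    rw [Path.range_segment] at hx hx'
    have hne' : (u.val, v.val) ≠ (u'.val, v'.val) := by
      intro e
      rw [Prod.mk.injEq] at e
      exact hne (Prod.ext (Fin.ext e.1) (Fin.ext e.2))
    rcases segment_inter_segment h h' hne' hx hx' with rfl | rfl | rfl | rfl <;>
      exact mem_range_self _

theorem drawing_isUpward (n : ℕ) : (drawing n).IsUpward := by
  intro u v h σ τ hlt
  have hne : (point u).2 < (point v).2 := NatAdj.up h
  have hlt' : (σ : ℝ) < τ := hlt
  change (Path.segment (point u) (point v) σ).2 < (Path.segment (point u) (point v) τ).2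
  simp only [Path.segment_apply, AffineMap.lineMap_apply_module, Prod.snd_add, Prod.smul_snd,
    smul_eq_mul]
  nlinarith

/-! ### Two-outerplanarity -/

/-- A vertex is on the boundary of the outer face if one of the two horizontal open rays from it
avoids the drawing; `ε` is the direction of the ray. -/
theorem PlanarDrawing.onOuterFace_of_ray {V : Type*} {G : Digraph V} (Γ : PlanarDrawing G) (v : V)
    {ε : ℝ} (hε : ε = 1 ∨ ε = -1)
    (h : ∀ p ∈ Γ.image, p.2 = (Γ.pos v).2 → ε * (p.1 - (Γ.pos v).1) ≤ 0) : Γ.OnOuterFace v := by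
  set f : ℝ → Plane := fun r => ((Γ.pos v).1 + ε * r, (Γ.pos v).2) with hf
  have hεε : ε * ε = 1 := by rcases hε with rfl | rfl <;> norm_num
  have hfc : Continuous f := by fun_prop
  have hray : f '' Ioi 0 ⊆ Γ.imageᶜ := by
    rintro _ ⟨r, hr, rfl⟩ hmem
    have := h _ hmem rfl
    simp only [hf] at this
    have hr' : (0 : ℝ) < r := hr
    nlinarith
  have hout : ∀ r > 0, f r ∈ Γ.outerFace := by
    intro r hr
    refine ⟨hray ⟨r, hr, rfl⟩, fun hb => ?_⟩
    have hsub : f '' Ioi 0 ⊆ connectedComponentIn Γ.imageᶜ (f r) :=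
      (isPreconnected_Ioi.image f hfc.continuousOn).subset_connectedComponentIn ⟨r, hr, rfl⟩ hray
    obtain ⟨C, hC⟩ := (hb.subset hsub).exists_norm_le
    have hC0 : 0 ≤ C := (norm_nonneg _).trans (hC (f 1) ⟨1, by simp, rfl⟩)
    -- a point of the ray whose first coordinate exceeds the bound
    have h1 := hC (f (C + |(Γ.pos v).1| + 1)) ⟨_, by
      have := abs_nonneg (Γ.pos v).1
      simp only [mem_Ioi]
      linarith, rfl⟩
    have h2 := (norm_fst_le _).trans h1
    simp only [hf, Real.norm_eq_abs] at h2
    have h3 := abs_le.1 h2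
    have h4 := neg_abs_le (Γ.pos v).1
    have h5 := le_abs_self (Γ.pos v).1
    rcases hε with rfl | rfl <;> linarith [h3.1, h3.2]
  have hv : Γ.pos v ∈ Γ.image := Or.inl (mem_range_self v)
  refine ⟨?_, fun hint => (interior_subset hint).1 hv⟩
  have ht : Filter.Tendsto f (nhdsWithin 0 (Ioi 0)) (nhds (Γ.pos v)) := by
    have := hfc.tendsto 0
    simp only [hf, mul_zero, add_zero] at this
    exact this.mono_left nhdsWithin_le_nhds
  exact mem_closure_of_tendsto ht (Filter.eventually_of_mem self_mem_nhdsWithin hout)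

/-- The direction of the horizontal ray from a vertex: right for the second copy, left for the
other vertices. -/
def side (w : ℕ) : ℤ := if 7 ≤ w ∧ w ≤ 11 then 1 else -1

/-- The vertices of the core that are not on the outer face. -/
def inner : List ℕ := [1, 2, 3, 4, 7, 8, 9]

/-- The edge `(i, j)` does not meet the open horizontal ray from `w`. -/
abbrev ClearEdge (w i j : ℕ) : Prop :=
  (coord w).2 < (coord i).2 ∨ (coord j).2 < (coord w).2 ∨
    side w * cross (coord i) (coord j) (coord w) ≤ 0

/-- The vertex `i` is not on the open horizontal ray from `w`. -/
abbrev ClearVertex (w i : ℕ) : Prop :=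
  (coord i).2 ≠ (coord w).2 ∨ side w * ((coord i).1 - (coord w).1) ≤ 0

theorem clearEdge_outer : ∀ w < 13, w ∉ inner → ∀ e ∈ coreEdges, ClearEdge w e.1 e.2 := by
  decide

theorem clearEdge_inner : ∀ w ∈ inner, ∀ e ∈ coreEdges, e.1 ∈ inner → e.2 ∈ inner →
    ClearEdge w e.1 e.2 := by
  decide

theorem clearVertex_core : ∀ w < 13, ∀ i < 13, ClearVertex w i := by
  decide

theorem ClearVertex.le {w i : ℕ} (h : ClearVertex w i) (e : (point i).2 = (point w).2) :
    (side w : ℝ) * ((point i).1 - (point w).1) ≤ 0 := by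
  rcases h with h | h
  · exact absurd (by simpa [point] using e) h
  · simp only [point]
    exact_mod_cast h

theorem ClearEdge.le {w i j : ℕ} (h : ClearEdge w i j) (hij : NatAdj i j) {x : Plane}
    (hx : x ∈ segment ℝ (point i) (point j)) (e : x.2 = (point w).2) :
    (side w : ℝ) * (x.1 - (point w).1) ≤ 0 := by
  have hI := snd_mem_of_mem_segment hij.up.le hx
  rcases h with h | h | h
  · exact absurd hI.1 (by rw [e]; exact (point_snd_lt h).not_ge)
  · exact absurd hI.2 (by rw [e]; exact (point_snd_lt h).not_ge)
  · have h1 : (side w : ℝ) * cross (point i) (point j) (point w) ≤ 0 := by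
      rw [cross_point]
      exact_mod_cast h
    have h2 := cross_eq_zero_of_mem_segment hx
    have h3 : cross (point i) (point j) (point w) =
        ((point j).2 - (point i).2) * (x.1 - (point w).1) := by
      rw [← sub_zero (cross _ _ _), ← h2]
      simp only [cross, e]
      ring
    rw [h3] at h1
    have h4 := sub_pos.2 hij.up
    by_contra! h5
    nlinarith [mul_pos h4 h5]

theorem side_cast (w : ℕ) : (side w : ℝ) = 1 ∨ (side w : ℝ) = -1 := by
  unfold side
  split_ifs <;> simp

theorem clearVertex (w i : ℕ) : ClearVertex w i := by
  rcases lt_or_ge w 13 with hw | hw <;> rcases lt_or_ge i 13 with hi | hi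
  · exact clearVertex_core w hw i hi
  · left
    rw [coord_of_le (show 12 ≤ i by omega)]
    rcases (show w < 12 ∨ w = 12 by omega) with h | rfl
    · have := core_low w h
      simp only
      omega
    · rw [coord_of_le le_rfl]
      simp only
      omega
  · left
    rw [coord_of_le (show 12 ≤ w by omega)]
    rcases (show i < 12 ∨ i = 12 by omega) with h | rfl
    · have := core_low i h
      simp only
      omega
    · rw [coord_of_le le_rfl]
      simp only
      omega
  · right
    rw [coord_of_le (show 12 ≤ i by omega), coord_of_le (show 12 ≤ w by omega)]
    simp

theorem clearEdge {w i j : ℕ} (hw : w ∉ inner) (h : NatAdj i j) : ClearEdge w i j := by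
  rcases h with h | ⟨h, rfl⟩ <;> rcases lt_or_ge w 13 with hw' | hw'
  · exact clearEdge_outer w hw' hw _ h
  · right
    left
    have := (edge_up _ h).2.1
    rw [coord_of_le (show 12 ≤ w by omega)]
    simp only at this ⊢
    omega
  · rcases (show w < 12 ∨ w = 12 by omega) with h' | rfl
    · left
      have := core_low w h'
      rw [coord_of_le h]
      simp only
      omega
    · right
      right
      simp [coord_of_le h, coord_of_le le_rfl, coord_of_le (show 12 ≤ i + 1 by omega), cross]
  · right
    right
    simp [coord_of_le h, coord_of_le (show 12 ≤ w by omega),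
      coord_of_le (show 12 ≤ i + 1 by omega), cross]

theorem drawing_onOuterFace {n : ℕ} (w : Fin n) (hw : w.val ∉ inner) :
    (drawing n).OnOuterFace w := by
  refine (drawing n).onOuterFace_of_ray w (side_cast w) ?_
  rintro p (⟨i, rfl⟩ | ⟨i, j, h, hp⟩) e
  · exact (clearVertex w i).le e
  · exact (clearEdge hw h).le h (by rwa [drawing, Path.range_segment] at hp) e

theorem isTwoOuterplanar (n : ℕ) : IsTwoOuterplanar (digraph n) := by
  have hin : ∀ w : ({v | ¬ (drawing n).OnOuterFace v} : Set (Fin n)), w.val.val ∈ inner := by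
    intro w
    by_contra h
    exact w.2 (drawing_onOuterFace w.val h)
  refine ⟨drawing n, fun w => PlanarDrawing.onOuterFace_of_ray _ w (side_cast w.val) ?_⟩
  rintro p (⟨i, rfl⟩ | ⟨i, j, h, hp⟩) e
  · exact (clearVertex w.val i.val).le e
  · have hp' : p ∈ segment ℝ (point i.val) (point j.val) := by
      rw [← Path.range_segment]
      exact hp
    have hc : ClearEdge w.val i.val j.val := by
      rcases h with h' | h'
      · exact clearEdge_inner _ (hin w) _ h' (hin i) (hin j)
      · have := (by decide : ∀ k ∈ inner, k < 12) _ (hin i)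
        omega
    exact hc.le h hp' e

end UpwardEmbedding

theorem mainTheorem2 (n : ℕ) (hn : 18 ≤ n) :
    ∃ (G : Digraph (Fin n)) (S : Finset UpwardEmbedding.Plane),
      UpwardEmbedding.IsStDigraph G ∧
      UpwardEmbedding.IsUpwardPlanar G ∧
      UpwardEmbedding.IsTwoOuterplanar G ∧
      S.card = n ∧
      UpwardEmbedding.IsUOSC S ∧
      ¬ UpwardEmbedding.AdmitsUPSE G S 1 :=
  ⟨UpwardEmbedding.digraph n, UpwardEmbedding.pointSet n,
    UpwardEmbedding.isStDigraph (by omega),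
    ⟨UpwardEmbedding.drawing n, UpwardEmbedding.drawing_isUpward n⟩,
    UpwardEmbedding.isTwoOuterplanar n,
    UpwardEmbedding.card_pointSet n,
    UpwardEmbedding.isUOSC_pointSet (by omega),
    UpwardEmbedding.not_admitsUPSE (by omega)⟩
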